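/- Let $X_1,X_2,\dots$ be real random variables on a probability space and $S_N=\sum_{n=1}^N X_n$. Suppose there are a complex Banach space $\mathbf B$, bounded linear operators $\mathcal L_t:\mathbf B\to\mathbf B$ ($t\in\mathbb R$), a vector $v\in\mathbf B$ and $\ell\in\mathbf B'$ with $\mathbb E(e^{itS_N})=\ell(\mathcal L_t^N v)$ for all $t\in\mathbb R$ and $N\ge 1$. Let $r\ge 0$ be an integer and $r_1>0$ a real number, and assume: (A1) $t\mapsto\mathcal L_t$ is continuous on $\mathbb R$ in operator norm and, for some $\delta>0$, is $r+2$ times continuously differentiable on $[-\delta,\delta]$. (A2) $1$ is an eigenvalue of $\mathcal L_0$ that is isolated in the spectrum and simple (of algebraic multiplicity one), all other eigenvalues of $\mathcal L_0$ have absolute value less than $1$, and the essential spectrum $\{z: z-\mathcal L_0 \text{ is not Fredholm}\}$ is contained in a disk $\{|z|\le\rho\}$ with $\rho<1$. (A3) For all $t\ne0$, the spectrum of $\mathcal L_t$ is contained in $\{|z|<1\}$. (A4) There are positive real numbers $K,r_2,N_0$ such that $\|\mathcal L_t^N\|\le N^{-r_2}$ for all $N>N_0$ and all $t$ with $K\le|t|\le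 N^{r_1}$. Let $q\in\mathbb N$ with $q>\frac{r+1}{2r_1}$. Let $F_0^{q+2}$ be the set of $(q+2)$ times continuously differentiable $f:\mathbb R\to\mathbb C$ for which $$\|f\|:=\max_{0\le j\le q+2}\|f^{(j)}\|_{L^1}+\|f\|_{L^1}<\infty .$$ Then there are $A\in\mathbb R$ and $\sigma^2\ge0$ such that $\frac{S_N-NA}{\sqrt N}$ converges in distribution to $\mathcal N(0,\sigma^2)$ (the point mass at $0$ if $\sigma^2=0$). Moreover, if $\sigma^2>0$, then $S_N$ admits the weak global Edgeworth expansion of order $r$ for $f\in F_0^{q+2}$: with $\mathfrak n(z)=\frac{1}{\sqrt{2\pi\sigma^2}}e^{-z^2/(2\sigma^2)}$, there are real polynomials $P_{0,g},\dots,P_{r,g}$, independent of $f$, such that $$\mathbb E\big(f(S_N-NA)\big)=\sum_{p=0}^r\frac1{N^{p/2}}\int_{\mathbb R}P_{p,g}(z)\,\mathfrak n(z)\,f\big(z\sqrt N\big)\,dz+\|f\|\,o\big(N^{-(r+1)/2}\big)\qquad(N\to\infty),$$ where the $o(\cdot)$ is uniform over $f\in F_0^{q+2}$. -/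

import Mathlib

open MeasureTheory ProbabilityTheory Filter Topology
open scoped NNReal ENNReal Polynomial

noncomputable section

namespace WeakEdgeworth

/-! ### Test functions -/

/-- `C^m(f) = max_{0 ≤ j ≤ m} ‖f^{(j)}‖_{L¹}`. -/
def derivNorm (m : ℕ) (f : ℝ → ℂ) : ℝ≥0∞ :=
  (Finset.range (m + 1)).sup fun j => eLpNorm (iteratedDeriv j f) 1 volume

/-- `C_k(f) = max_{0 ≤ j ≤ k} ‖x^j f‖_{L¹}`. -/
def momentNorm (k : ℕ) (f : ℝ → ℂ) : ℝ≥0∞ :=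
  (Finset.range (k + 1)).sup fun j => eLpNorm (fun x : ℝ => (x : ℂ) ^ j * f x) 1 volume

/-- `C^m_k(f) = C^m(f) + C_k(f)`, as an extended nonnegative number. -/
def testENorm (m k : ℕ) (f : ℝ → ℂ) : ℝ≥0∞ :=
  derivNorm m f + momentNorm k f

/-- The space `F^m_k`: functions that are `m` times continuously differentiable
with `C^m_k(f) < ∞`. -/
def testSpace (m k : ℕ) : Set (ℝ → ℂ) :=
  {f | ContDiff ℝ m f ∧ testENorm m k f < ∞}

/-- The norm `C^m_k(f)` of an element of `F^m_k`. -/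
def testNorm (m k : ℕ) (f : ℝ → ℂ) : ℝ :=
  (testENorm m k f).toReal

/-! ### Partial sums, the central limit theorem and the weak global expansion -/

/-- `S_N = X_1 + ⋯ + X_N`. -/
def partialSum {Ω : Type*} (X : ℕ → Ω → ℝ) (N : ℕ) (ω : Ω) : ℝ :=
  ∑ n ∈ Finset.Icc 1 N, X n ω

/-- `(S_N - N A) / √N` converges in distribution to the normal law with mean `0` and
variance `v` (the point mass at `0` if `v = 0`). -/
def SatisfiesCLT {Ω : Type*} [MeasurableSpace Ω] (μ : Measure Ω) [IsProbabilityMeasure μ]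
    (S : ℕ → Ω → ℝ) (A : ℝ) (v : ℝ≥0) : Prop :=
  TendstoInDistribution (fun (N : ℕ) (ω : Ω) => (S N ω - N * A) / √N) atTop
    (id : ℝ → ℝ) (fun _ => μ) (gaussianReal 0 v)

/-- `S_N` admits the weak global Edgeworth expansion of order `r` on the class `𝓕` of functions
with norm `nrm`, with centring `A` and with `𝔫` the centred normal density of variance `v`.
The polynomials do not depend on `f`, and the error is `nrm f * o(N^{-(r+1)/2})` with the
`o(⋅)` uniform in `f ∈ 𝓕`. -/
def AdmitsWeakGlobalExpansion {Ω : Type*} [MeasurableSpace Ω] (μ : Measure Ω)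
    (S : ℕ → Ω → ℝ) (A : ℝ) (v : ℝ≥0) (r : ℕ)
    (𝓕 : Set (ℝ → ℂ)) (nrm : (ℝ → ℂ) → ℝ) : Prop :=
  ∃ P : ℕ → ℝ[X], ∀ ε : ℝ, 0 < ε → ∀ᶠ N : ℕ in atTop, ∀ f ∈ 𝓕,
    ‖(∫ ω, f (S N ω - N * A) ∂μ) -
        ∑ p ∈ Finset.range (r + 1), (((N : ℝ) ^ (-(p : ℝ) / 2) : ℝ) : ℂ) *
          ∫ z : ℝ, (((P p).eval z * gaussianPDFReal 0 v z : ℝ) : ℂ) * f (z * √N)‖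
      ≤ nrm f * (ε * (N : ℝ) ^ (-((r : ℝ) + 1) / 2))

/-! ### Assumptions on the family of operators -/

section Operators

variable {B : Type*} [NormedAddCommGroup B] [NormedSpace ℂ B]

/-- The essential spectrum: all `z` such that `z - T` is not a Fredholm operator. -/
def essentialSpectrum (T : B →L[ℂ] B) : Set ℂ :=
  {z | ¬ (algebraMap ℂ (B →L[ℂ] B) z - T).IsFredholm}

/-- (A1) with smoothness `s`. -/
def RegularFamily (s : ℕ) (L : ℝ → B →L[ℂ] B) : Prop :=
  Continuous L ∧ ∃ δ : ℝ, 0 < δ ∧ ContDiffOn ℝ s L (Set.Icc (-δ) δ)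

/-- (A2) for the operator `T`: `1` is an eigenvalue, isolated in the spectrum and simple
(of algebraic multiplicity one), all other eigenvalues have modulus less than `1`, and the
essential spectrum lies in a disk of radius strictly less than `1`. -/
structure HasSpectralGap (T : B →L[ℂ] B) : Prop where
  eigenvalue_one : Module.End.HasEigenvalue (T : B →ₗ[ℂ] B) 1
  isolated : ∀ᶠ z : ℂ in 𝓝[≠] 1, z ∉ spectrum ℂ T
  simple : Module.finrank ℂ (Module.End.maxGenEigenspace (T : B →ₗ[ℂ] B) 1) = 1
  other_eigenvalues : ∀ z : ℂ, Module.End.HasEigenvalue (T : B →ₗ[ℂ] B) z → z ≠ 1 → ‖z‖ < 1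
  essential : ∃ ρ : ℝ, ρ < 1 ∧ essentialSpectrum T ⊆ Metric.closedBall 0 ρ

/-- (A3). -/
def SpectrumInsideDisk (L : ℝ → B →L[ℂ] B) : Prop :=
  ∀ t : ℝ, t ≠ 0 → spectrum ℂ (L t) ⊆ {z | ‖z‖ < 1}

/-- (A4) with exponent `r₁`. -/
def PolynomialDecay (r₁ : ℝ) (L : ℝ → B →L[ℂ] B) : Prop :=
  ∃ K r₂ N₀ : ℝ, 0 < K ∧ 0 < r₂ ∧ 0 < N₀ ∧
    ∀ N : ℕ, N₀ < N → ∀ t : ℝ, K ≤ |t| → |t| ≤ (N : ℝ) ^ r₁ →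
      ‖L t ^ N‖ ≤ 1 / (N : ℝ) ^ r₂

end Operators

end WeakEdgeworth

end

/-! The proof is the Nagaev–Guivarc'h spectral method followed by Fourier inversion.

By (A2), `L 0` is a rank one projection plus a complementary operator of spectral radius below one
(`HasSpectralGap.exists_decomposition`). Perturbing in `t`, the characteristic function of `S_N`
near `0` equals `lam t ^ N * a t` up to an exponentially small error, with `lam` and `a` as smooth
as `L` (`exists_eigenvalue_expansion`). Since these are characteristic functions, `a 0 = 1`, `|lam|
≤ 1`, and both functions are hermitian (`eigenvalue_symmetry`). Hence `log lam` has the Taylor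
polynomial `iAu - σ²u²/2 - u²τ(iu)` with `A` real, `σ² ≥ 0` and `τ` a real polynomial vanishing at
`0`. The central limit theorem follows by Lévy continuity at `u = s/√N`.

If `σ² > 0`, truncating the expansion of `exp(-Nu²τ(iu)) a(u)` gives `edgeworthSum`. Its error near
`0` is `o(|u|^r)` times a polynomial in `Nu²` times a Gaussian (`local_edgeworth`), and the
substitution `s = √N u` turns its integral into `o(N^{-(r+1)/2})`. In the variable `s`, the factor
`N^{-p/2}` multiplies a real polynomial in `is` times the Gaussian characteristic function, that is,
the Fourier transform of a real polynomial times the density.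

Away from `0` there are three ranges of frequencies. For `δ ≤ |u| ≤ K`, (A3) and compactness give
exponential decay. For `K ≤ |u| ≤ c N^{r₁}`, submultiplicativity improves (A4) to any power of `N`.
Beyond that only the trivial bound `1` is left, and the transform of `f` must pay: `q` derivatives
give `N^{-r₁q}`, negligible because `q > (r+1)/(2r₁)`, and two more give integrability. Only the
norm of `f` enters, so the error is uniform. -/

namespace WeakEdgeworth

/-! ### Spectral decomposition of a quasi-compact operator -/

section SpectralGap

variable {B : Type*} [NormedAddCommGroup B] [NormedSpace ℂ B] [CompleteSpace B]

/-- An operator that is bounded below and is a limit of invertible operators is invertible. -/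
theorem isUnit_of_boundedBelow_of_mem_closure {S : B →L[ℂ] B} {c : ℝ} (hc : 0 < c)
    (hS : ∀ x, c * ‖x‖ ≤ ‖S x‖) (hcl : S ∈ closure {T : B →L[ℂ] B | IsUnit T}) : IsUnit S := by
  rcases subsingleton_or_nontrivial B with hB | hB
  · have : S = 1 := by ext x; exact Subsingleton.elim _ _
    rw [this]; exact isUnit_one
  -- At distance `c / 2` the unit `u` is still bounded below by `c / 2`, so `‖u⁻¹‖ ≤ 2 / c` and `S`
  -- lies in the ball of invertible operators around `u`.
  obtain ⟨_, ⟨u, rfl⟩, hu⟩ := Metric.mem_closure_iff.1 hcl (c / 2) (by positivity)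
  have hinv : ‖((u⁻¹ : (B →L[ℂ] B)ˣ) : B →L[ℂ] B)‖ ≤ 2 / c := by
    refine ContinuousLinearMap.opNorm_le_bound _ (by positivity) fun y => ?_
    set x := ((u⁻¹ : (B →L[ℂ] B)ˣ) : B →L[ℂ] B) y with hx
    have hux : (u : B →L[ℂ] B) x = y := by
      have : ((u : B →L[ℂ] B) * ((u⁻¹ : (B →L[ℂ] B)ˣ) : B →L[ℂ] B)) y = y := by
        rw [Units.mul_inv]; rfl
      exact this
    have h1 : ‖S x‖ ≤ ‖y‖ + c / 2 * ‖x‖ := by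
      calc ‖S x‖ = ‖(u : B →L[ℂ] B) x + (S - u) x‖ := by simp
        _ ≤ ‖(u : B →L[ℂ] B) x‖ + ‖(S - u) x‖ := norm_add_le _ _
        _ ≤ ‖y‖ + c / 2 * ‖x‖ := by
          rw [hux]
          have := (S - (u : B →L[ℂ] B)).le_opNorm x
          rw [dist_eq_norm] at hu
          nlinarith [norm_nonneg x]
    have h2 := hS x
    rw [div_mul_eq_mul_div, le_div_iff₀ hc]
    nlinarith
  have hpos : 0 < ‖((u⁻¹ : (B →L[ℂ] B)ˣ) : B →L[ℂ] B)‖ := Units.norm_pos _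
  refine ⟨Units.ofNearby u S ?_, rfl⟩
  rw [← dist_eq_norm]
  refine lt_of_lt_of_le hu ?_
  rw [le_inv_comm₀ (by positivity) hpos]
  simpa using hinv

theorem boundedBelow_of_antilipschitz {E F : Type*} [NormedAddCommGroup E] [NormedSpace ℂ E]
    [NormedAddCommGroup F] [NormedSpace ℂ F] {S : E →L[ℂ] F} {K : ℝ≥0}
    (h : AntilipschitzWith K S) : ∃ c : ℝ, 0 < c ∧ ∀ x, c * ‖x‖ ≤ ‖S x‖ := by
  refine ⟨((K : ℝ) + 1)⁻¹, by positivity, fun x => ?_⟩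
  rw [inv_mul_le_iff₀ (by positivity)]
  have := h.le_mul_dist x 0
  simp only [dist_zero_right, map_zero] at this
  nlinarith [norm_nonneg (S x)]

omit [CompleteSpace B] in
theorem injective_of_not_hasEigenvalue {T : B →L[ℂ] B} {z : ℂ}
    (h : ¬ Module.End.HasEigenvalue (T : B →ₗ[ℂ] B) z) :
    Function.Injective (algebraMap ℂ (B →L[ℂ] B) z - T) := by
  rw [injective_iff_map_eq_zero]
  intro x hx
  by_contra hx0
  refine h (Module.End.hasEigenvalue_of_hasEigenvector (x := x) ⟨?_, hx0⟩)
  rw [Module.End.mem_eigenspace_iff]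
  have : z • x - T x = 0 := by simpa [Algebra.algebraMap_eq_smul_one] using hx
  exact (sub_eq_zero.1 this).symm

/-- On the exterior of the essential spectrum, a boundary point of the spectrum
is an eigenvalue. -/
theorem hasEigenvalue_of_mem_spectrum_of_mem_closure {T : B →L[ℂ] B} {z : ℂ}
    (hz : z ∈ spectrum ℂ T) (hcl : z ∈ closure (resolventSet ℂ T)) (hess : z ∉ essentialSpectrum T) :
    Module.End.HasEigenvalue (T : B →ₗ[ℂ] B) z := by
  by_contra hne
  have hfred : (algebraMap ℂ (B →L[ℂ] B) z - T).IsFredholm := by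
    simpa [essentialSpectrum] using hess
  obtain ⟨K, hK⟩ := (algebraMap ℂ (B →L[ℂ] B) z - T).antilipschitz_of_injective_of_isClosed_range
    (injective_of_not_hasEigenvalue hne)
    (by have := hfred.isClosed_range; rwa [LinearMap.coe_range] at this)
  obtain ⟨c, hc, hb⟩ := boundedBelow_of_antilipschitz hK
  refine hz (isUnit_of_boundedBelow_of_mem_closure hc hb ?_)
  have hcont : Continuous fun w : ℂ => algebraMap ℂ (B →L[ℂ] B) w - T :=
    (algebraMapCLM ℂ (B →L[ℂ] B)).continuous.sub continuous_const
  exact map_mem_closure (f := fun w : ℂ => algebraMap ℂ (B →L[ℂ] B) w - T) hcont hcl fun w hw => hw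

/-- Away from the isolated point `1` the spectrum is compact, so it has a point `w` of maximal
modulus. If `‖w‖ ≥ 1`, then `w` is a radial limit of resolvent points outside the essential
spectrum, hence an eigenvalue other than `1`, which (A2) forbids. -/
theorem HasSpectralGap.norm_lt_one_of_mem_spectrum {T : B →L[ℂ] B} (hT : HasSpectralGap T) {z : ℂ}
    (hz : z ∈ spectrum ℂ T) (hz1 : z ≠ 1) : ‖z‖ < 1 := by
  obtain ⟨ρ, hρ, hess⟩ := hT.essential
  have hopen : ∃ U : Set ℂ, IsOpen U ∧ (1 : ℂ) ∈ U ∧ ∀ w ∈ U, w ≠ 1 → w ∉ spectrum ℂ T := by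
    have := hT.isolated
    rw [eventually_nhdsWithin_iff] at this
    obtain ⟨U, hU, hUo, h1⟩ := eventually_nhds_iff.1 this
    exact ⟨U, hUo, h1, fun w hw hne => hU w hw hne⟩
  obtain ⟨U, hUo, h1U, hU⟩ := hopen
  have hcomp : IsCompact (spectrum ℂ T \ U) := (spectrum.isCompact T).diff hUo
  obtain ⟨w, hw, hmax⟩ := hcomp.exists_isMaxOn
    ⟨z, hz, fun h => hU z h hz1 hz⟩ continuous_norm.continuousOn
  have hle : ∀ x ∈ spectrum ℂ T, x ≠ 1 → ‖x‖ ≤ ‖w‖ := fun x hx hx1 =>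
    hmax (show x ∈ spectrum ℂ T \ U from ⟨hx, fun h => hU x h hx1 hx⟩)
  refine (hle z hz hz1).trans_lt ?_
  by_contra hw1
  push Not at hw1
  have hwne : w ≠ 1 := fun h => hw.2 (h ▸ h1U)
  have hcl : w ∈ closure (resolventSet ℂ T) := by
    refine mem_closure_of_tendsto (f := fun s : ℝ => ((s : ℝ) : ℂ) * w) (b := 𝓝[>] (1 : ℝ)) ?_ ?_
    · have : ContinuousAt (fun s : ℝ => ((s : ℝ) : ℂ) * w) 1 := by fun_prop
      have h2 := this.tendsto
      simp only [Complex.ofReal_one, one_mul] at h2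
      exact h2.mono_left nhdsWithin_le_nhds
    · have hc : ContinuousAt (fun s : ℝ => ((s : ℝ) : ℂ) * w) 1 := by fun_prop
      have hne : ∀ᶠ s : ℝ in 𝓝 1, ((s : ℝ) : ℂ) * w ≠ 1 :=
        hc.eventually_ne (by simpa using hwne)
      filter_upwards [nhdsWithin_le_nhds hne, self_mem_nhdsWithin] with s hs hs1
      have hs1 : 1 < s := hs1
      by_contra hcon
      have := hle _ (by simpa [spectrum] using hcon) hs
      rw [norm_mul, Complex.norm_real, Real.norm_of_nonneg (by linarith)] at this
      nlinarith
  have hnot : w ∉ essentialSpectrum T := fun h => by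
    have := hess h
    rw [Metric.mem_closedBall, dist_zero_right] at this
    linarith
  have := hT.other_eigenvalues w (hasEigenvalue_of_mem_spectrum_of_mem_closure hw.1 hcl hnot) hwne
  linarith

omit [CompleteSpace B] in
/-- Away from `0` and `1`, removing the spectral projection at `1` preserves the resolvent set. -/
theorem isUnit_sub_sub_projection {T P : B →L[ℂ] B} (hP : P * P = P) (hTP : T * P = P) {z : ℂ}
    (hz0 : z ≠ 0) (hz1 : z ≠ 1) (hz : z ∉ spectrum ℂ T) :
    IsUnit (algebraMap ℂ (B →L[ℂ] B) z - (T - P)) := by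
  have hz1' : z - 1 ≠ 0 := sub_ne_zero.2 hz1
  -- `(z - T) P = (z - 1) P`, so adding `P` to `z - T` amounts to multiplying by this factor. It
  -- acts as `z / (z - 1)` on the range of `P`, which gives the inverse `1 - z⁻¹ P`.
  have hu : IsUnit (1 + (z - 1)⁻¹ • P) := by
    refine ⟨⟨1 + (z - 1)⁻¹ • P, 1 - z⁻¹ • P, ?_, ?_⟩, rfl⟩
    all_goals
      simp only [mul_sub, add_mul, sub_mul, mul_add, one_mul, mul_one, smul_mul_assoc,
        mul_smul_comm, hP]
      match_scalars <;> field_simp <;> ring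
  have hz' : IsUnit (algebraMap ℂ (B →L[ℂ] B) z - T) := by simpa [spectrum, resolventSet] using hz
  have : algebraMap ℂ (B →L[ℂ] B) z - (T - P)
      = (algebraMap ℂ (B →L[ℂ] B) z - T) * (1 + (z - 1)⁻¹ • P) := by
    rw [Algebra.algebraMap_eq_smul_one]
    simp only [mul_add, sub_mul, mul_one, mul_smul_comm, smul_mul_assoc, one_mul, hTP]
    match_scalars <;> field_simp
  rw [this]
  exact hz'.mul hu

omit [CompleteSpace B] in
theorem exists_functional_vanishing_on_closed_submodule {R : Submodule ℂ B}
    (hR : IsClosed (R : Set B)) {e : B} (he : e ∉ R) :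
    ∃ φ : B →L[ℂ] ℂ, φ e = 1 ∧ ∀ x ∈ R, φ x = 0 := by
  let : NormedAddCommGroup (B ⧸ R) := Submodule.Quotient.normedAddCommGroup _
  obtain ⟨ψ, hψ⟩ := SeparatingDual.exists_eq_one (R := ℂ) (x := R.mkQ e) (by simpa using he)
  refine ⟨ψ.comp R.mkQL, hψ, fun x hx => ?_⟩
  have : R.mkQL x = 0 := (Submodule.Quotient.mk_eq_zero _).2 hx
  rw [ContinuousLinearMap.comp_apply, this, map_zero]

omit [CompleteSpace B] in
-- Simplicity excludes Jordan chains, so `e` is not in the range of `1 - T`. This range is closed by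
-- the Fredholm property, and Hahn–Banach yields a functional that vanishes on it, that is, a left
-- eigenvector, normalised at `e`.
theorem HasSpectralGap.exists_eigenvectors {T : B →L[ℂ] B} (hT : HasSpectralGap T) :
    ∃ (e : B) (φ : B →L[ℂ] ℂ), T e = e ∧ (∀ x, φ (T x) = φ x) ∧ φ e = 1 ∧
      (∀ x, T x = x → x = φ x • e) ∧ IsClosed (Set.range (1 - T : B →L[ℂ] B)) := by
  obtain ⟨ρ, hρ, hess⟩ := hT.essential
  have hfred : (algebraMap ℂ (B →L[ℂ] B) 1 - T).IsFredholm := by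
    have : (1 : ℂ) ∉ essentialSpectrum T := fun h => by
      have := hess h
      rw [Metric.mem_closedBall, dist_zero_right, norm_one] at this
      linarith
    simpa [essentialSpectrum] using this
  rw [map_one] at hfred
  obtain ⟨e, he⟩ := hT.eigenvalue_one.exists_hasEigenvector
  have hTe : T e = e := by simpa using he.apply_eq_smul
  have hgen : ∀ x : B, ((T : B →ₗ[ℂ] B) - algebraMap ℂ (Module.End ℂ B) 1) ^ 2 • x = 0 →
      ∃ c : ℂ, c • e = x := by
    intro x hx
    have hmem : ∀ y : B, ((T : B →ₗ[ℂ] B) - algebraMap ℂ (Module.End ℂ B) 1) ^ 2 • y = 0 →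
        y ∈ Module.End.maxGenEigenspace (T : B →ₗ[ℂ] B) 1 := by
      intro y hy
      rw [Module.End.mem_maxGenEigenspace]
      exact ⟨2, by simpa [Algebra.algebraMap_eq_smul_one] using hy⟩
    have he2 : e ∈ Module.End.maxGenEigenspace (T : B →ₗ[ℂ] B) 1 := hmem e (by
      simp [pow_two, hTe])
    obtain ⟨c, hc⟩ := (finrank_eq_one_iff_of_nonzero'
      (⟨e, he2⟩ : Module.End.maxGenEigenspace (T : B →ₗ[ℂ] B) 1)
      (fun h => he.2 (congrArg Subtype.val h))).1 hT.simple ⟨x, hmem x hx⟩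
    exact ⟨c, congrArg Subtype.val hc⟩
  have hcl : IsClosed (Set.range (1 - T : B →L[ℂ] B)) := by
    have := hfred.isClosed_range; rwa [LinearMap.coe_range] at this
  -- A preimage `y` of `e` would satisfy `(T - 1)² y = 0`, hence be a multiple of `e`, and then `(1
  -- - T) y = 0`.
  have hnot : e ∉ (1 - T : B →L[ℂ] B).range := by
    rintro ⟨y, hy⟩
    have hy' : y - T y = e := by simpa using hy
    have hTy : T y = y - e := by rw [← hy']; abel
    obtain ⟨c, rfl⟩ := hgen y (by simp [pow_two, hTy, hTe])
    apply he.2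
    rw [← hy', map_smul, hTe, sub_self]
  have : ∃ φ : B →L[ℂ] ℂ, φ e = 1 ∧ ∀ x ∈ (1 - T : B →L[ℂ] B).range, φ x = 0 := by
    refine exists_functional_vanishing_on_closed_submodule ?_ hnot
    rwa [LinearMap.coe_range]
  obtain ⟨φ, hφe, hφ⟩ := this
  refine ⟨e, φ, hTe, fun x => ?_, hφe, fun x hx => ?_, hcl⟩
  · have := hφ ((1 - T : B →L[ℂ] B) x) ⟨x, rfl⟩
    simp only [sub_apply, one_apply_eq_self, map_sub] at this
    exact (sub_eq_zero.1 this).symm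
  · obtain ⟨c, rfl⟩ := hgen x (by simp [pow_two, hx])
    simp [hφe]

/-- A quasi-compact operator with simple dominant eigenvalue `1` splits as a rank one projection
plus an operator of spectral radius less than one. -/
theorem HasSpectralGap.exists_decomposition {T : B →L[ℂ] B} (hT : HasSpectralGap T) :
    ∃ (e : B) (φ : B →L[ℂ] ℂ), T e = e ∧ (∀ x, φ (T x) = φ x) ∧ φ e = 1 ∧
      spectrum ℂ (T - φ.smulRight e) ⊆ {z | ‖z‖ < 1} := by
  obtain ⟨e, φ, hTe, hφT, hφe, hker, hcl⟩ := hT.exists_eigenvectors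
  refine ⟨e, φ, hTe, hφT, hφe, ?_⟩
  set P : B →L[ℂ] B := φ.smulRight e with hPdef
  have hP : P * P = P := by ext x; simp [hPdef, hφe]
  have hTP : T * P = P := by ext x; simp [hPdef, hTe]
  have hunit : ∀ z : ℂ, z ≠ 0 → z ≠ 1 → z ∉ spectrum ℂ T →
      IsUnit (algebraMap ℂ (B →L[ℂ] B) z - (T - P)) := fun z h0 h1 h =>
    isUnit_sub_sub_projection hP hTP h0 h1 h
  -- At `z = 1` the factorisation of `isUnit_sub_sub_projection` breaks down. Instead the operator
  -- is shown to be bounded below and a limit of the invertible ones with `z` near `1`.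
  have hone : IsUnit (algebraMap ℂ (B →L[ℂ] B) 1 - (T - P)) := by
    have happ : ∀ x, (algebraMap ℂ (B →L[ℂ] B) 1 - (T - P)) x = (1 - T : B →L[ℂ] B) x + φ x • e := by
      intro x; simp [hPdef]; abel
    have hbelow : ∃ c : ℝ, 0 < c ∧ ∀ x : φ.ker, c * ‖x‖ ≤ ‖((1 - T : B →L[ℂ] B).comp φ.ker.subtypeL) x‖ := by
      have hinj : Function.Injective ((1 - T : B →L[ℂ] B).comp φ.ker.subtypeL) := by
        rw [injective_iff_map_eq_zero]
        rintro ⟨x, hx⟩ h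
        have hx0 : φ x = 0 := hx
        have h' : x - T x = 0 := by simpa using h
        have := hker x (sub_eq_zero.1 h').symm
        rw [hx0, zero_smul] at this
        exact Subtype.ext this
      have hrange : Set.range ((1 - T : B →L[ℂ] B).comp φ.ker.subtypeL) = Set.range (1 - T : B →L[ℂ] B) := by
        apply Set.Subset.antisymm
        · rintro _ ⟨x, rfl⟩; exact ⟨x, rfl⟩
        · rintro _ ⟨x, rfl⟩
          refine ⟨⟨x - φ x • e, ?_⟩, ?_⟩
          · simp [hφe]
          · simp [hTe]
      have : CompleteSpace φ.ker := (φ.isClosed_ker).completeSpace_coe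
      obtain ⟨K, hK⟩ := ((1 - T : B →L[ℂ] B).comp φ.ker.subtypeL).antilipschitz_of_injective_of_isClosed_range
        hinj (hrange ▸ hcl)
      exact boundedBelow_of_antilipschitz hK
    obtain ⟨c, hc, hb⟩ := hbelow
    -- The constant comes from splitting `x` along `ker φ` and `e`: the `e` component is controlled
    -- by `φ y = φ x`, the other one by the lower bound `c` of `1 - T` on `ker φ`.
    refine isUnit_of_boundedBelow_of_mem_closure
      (c := (‖φ‖ * ‖e‖ + c⁻¹ * (1 + ‖φ‖ * ‖e‖) + 1)⁻¹) (by positivity) (fun x => ?_) ?_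
    · set y := (algebraMap ℂ (B →L[ℂ] B) 1 - (T - P)) x with hy
      have hφy : φ y = φ x := by
        rw [hy, happ]; simp [hφT, hφe]
      have h1 : ‖φ x • e‖ ≤ ‖φ‖ * ‖e‖ * ‖y‖ := by
        rw [norm_smul, ← hφy]
        have := φ.le_opNorm y
        nlinarith [norm_nonneg e]
      have h2 : c * ‖x - φ x • e‖ ≤ ‖(1 - T : B →L[ℂ] B) x‖ := by
        have := hb ⟨x - φ x • e, by simp [hφe]⟩
        simpa [hTe] using this
      have h3 : ‖(1 - T : B →L[ℂ] B) x‖ ≤ (1 + ‖φ‖ * ‖e‖) * ‖y‖ := by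
        have : (1 - T : B →L[ℂ] B) x = y - φ x • e := by rw [hy, happ]; abel
        rw [this]
        refine (norm_sub_le _ _).trans ?_
        linarith
      have h4 : ‖x‖ ≤ ‖x - φ x • e‖ + ‖φ x • e‖ := by
        simpa using norm_add_le (x - φ x • e) (φ x • e)
      have h5 : ‖x - φ x • e‖ ≤ c⁻¹ * ((1 + ‖φ‖ * ‖e‖) * ‖y‖) := by
        rw [le_inv_mul_iff₀ hc]; linarith
      rw [inv_mul_le_iff₀ (by positivity)]
      nlinarith [norm_nonneg y]
    · have hcont : Continuous fun w : ℂ => algebraMap ℂ (B →L[ℂ] B) w - (T - P) :=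
        (algebraMapCLM ℂ (B →L[ℂ] B)).continuous.sub continuous_const
      refine mem_closure_of_tendsto (b := 𝓝[≠] (1 : ℂ)) (hcont.tendsto 1 |>.mono_left
        nhdsWithin_le_nhds) ?_
      filter_upwards [hT.isolated, self_mem_nhdsWithin,
        nhdsWithin_le_nhds (isOpen_ne.mem_nhds (one_ne_zero (α := ℂ)))] with z hz hz1 hz0
      exact hunit z hz0 hz1 hz
  intro z hz
  by_contra hz1
  simp only [Set.mem_ofPred_eq, not_lt] at hz1
  refine hz ?_
  rcases eq_or_ne z 1 with rfl | hne
  · exact hone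
  · refine hunit z (fun h => ?_) hne fun h => ?_
    · rw [h, norm_zero] at hz1; linarith
    · have := hT.norm_lt_one_of_mem_spectrum h hne
      linarith

end SpectralGap

end WeakEdgeworth

namespace WeakEdgeworth

/-! ### Perturbation of the dominant eigenvalue -/

section Perturbation

variable {B : Type*} [NormedAddCommGroup B] [NormedSpace ℂ B]

theorem opNorm_pow_le_of_le {S : B →L[ℂ] B} {b : ℝ} (hb : ‖S‖ ≤ b) (n : ℕ) : ‖S ^ n‖ ≤ b ^ n := by
  induction n with
  | zero => rw [pow_zero, pow_zero]; exact ContinuousLinearMap.norm_id_le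
  | succ n ih =>
    rw [pow_succ, pow_succ]
    exact (norm_mul_le _ _).trans (mul_le_mul ih hb (norm_nonneg _) ((norm_nonneg _).trans ih))

/-- If some power of `S` has norm at most `1/2`, the powers of `S` decay exponentially. -/
theorem norm_pow_le_of_norm_pow_le_half {S : B →L[ℂ] B} {b κ : ℝ} {n : ℕ} (hn : 0 < n) (hb1 : 1 ≤ b)
    (hb : ‖S‖ ≤ b) (hκ0 : 0 < κ) (hκ1 : κ < 1) (hκ : κ ^ n = 1 / 2) (hS : ‖S ^ n‖ ≤ 1 / 2) (N : ℕ) :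
    ‖S ^ N‖ ≤ 2 * b ^ n * κ ^ N := by
  have hN : N = n * (N / n) + N % n := (Nat.div_add_mod N n).symm
  have hmod : N % n < n := Nat.mod_lt _ hn
  have h1 : ‖S ^ (n * (N / n))‖ ≤ (1 / 2) ^ (N / n) := by
    rw [pow_mul]; exact opNorm_pow_le_of_le hS _
  have h2 : ‖S ^ (N % n)‖ ≤ b ^ n :=
    (opNorm_pow_le_of_le hb _).trans (pow_le_pow_right₀ hb1 hmod.le)
  have h3 : (1 / 2 : ℝ) ^ (N / n) ≤ 2 * κ ^ N := by
    have : κ ^ N = (1 / 2) ^ (N / n) * κ ^ (N % n) := by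
      conv_lhs => rw [hN, pow_add, pow_mul, hκ]
    rw [this]
    have h4 : (1 / 2 : ℝ) ≤ κ ^ (N % n) := by
      rw [← hκ]; exact pow_le_pow_of_le_one hκ0.le hκ1.le hmod.le
    have : (0 : ℝ) < (1 / 2) ^ (N / n) := by positivity
    nlinarith
  calc ‖S ^ N‖ = ‖S ^ (n * (N / n)) * S ^ (N % n)‖ := by rw [← pow_add, ← hN]
    _ ≤ ‖S ^ (n * (N / n))‖ * ‖S ^ (N % n)‖ := norm_mul_le _ _
    _ ≤ (2 * κ ^ N) * b ^ n :=
      mul_le_mul (h1.trans h3) h2 (norm_nonneg _) (by positivity)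
    _ = 2 * b ^ n * κ ^ N := by ring

/-- Powers of operators near one with spectrum in the open unit disk decay exponentially,
uniformly. -/
theorem eventually_norm_pow_le [CompleteSpace B] {T : B →L[ℂ] B}
    (hT : spectrum ℂ T ⊆ {z | ‖z‖ < 1}) :
    ∃ C κ : ℝ, 0 ≤ C ∧ 0 < κ ∧ κ < 1 ∧ ∀ᶠ S in 𝓝 T, ∀ N : ℕ, ‖S ^ N‖ ≤ C * κ ^ N := by
  rcases subsingleton_or_nontrivial B with hB | hB
  · refine ⟨0, 1 / 2, le_rfl, by norm_num, by norm_num, Eventually.of_forall fun S N => ?_⟩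
    rw [Subsingleton.elim (S ^ N) 0]; simp
  have hsr : spectralRadius ℂ T < ((1 : ℝ≥0) : ℝ≥0∞) := by
    refine spectrum.spectralRadius_lt_of_forall_lt_of_nonempty (spectrum.nonempty T) fun z hz => ?_
    have : ‖z‖ < 1 := hT hz
    exact_mod_cast this
  obtain ⟨ρ, hρ1, hρ2⟩ := ENNReal.lt_iff_exists_nnreal_btwn.1 hsr
  have hρ2' : (ρ : ℝ) < 1 := by exact_mod_cast hρ2
  have hlim := spectrum.pow_nnnorm_pow_one_div_tendsto_nhds_spectralRadius T
  have hpow := (tendsto_pow_atTop_nhds_zero_of_lt_one ρ.2 hρ2').eventually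
    (gt_mem_nhds (show (0 : ℝ) < 1 / 2 by norm_num))
  -- Gelfand's formula gives one `n` with `‖T ^ n‖ ≤ ρ ^ n < 1 / 2`. This bound and `‖S‖ < ‖T‖ + 1`
  -- are open conditions on `S`, whence the uniformity near `T`.
  obtain ⟨n, ⟨h1, h2⟩, hn⟩ := (((hlim.eventually (gt_mem_nhds hρ1)).and hpow).and
    (eventually_gt_atTop 0)).exists
  have hTn : ‖T ^ n‖ < 1 / 2 := by
    refine lt_of_le_of_lt ?_ h2
    have h3 : ((‖T ^ n‖₊ : ℝ≥0∞) ^ (1 / (n : ℝ))) ^ (n : ℝ) ≤ (ρ : ℝ≥0∞) ^ (n : ℝ) :=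
      ENNReal.rpow_le_rpow h1.le (Nat.cast_nonneg n)
    rw [← ENNReal.rpow_mul, one_div_mul_cancel (by positivity), ENNReal.rpow_one,
      ENNReal.rpow_natCast] at h3
    have : ‖T ^ n‖₊ ≤ ρ ^ n := by exact_mod_cast h3
    exact_mod_cast this
  set κ : ℝ := (1 / 2 : ℝ) ^ ((n : ℝ)⁻¹) with hκ
  have hκn : κ ^ n = 1 / 2 := Real.rpow_inv_natCast_pow (by norm_num) hn.ne'
  have hκ0 : 0 < κ := by positivity
  have hκ1 : κ < 1 := Real.rpow_lt_one (by norm_num) (by norm_num) (by positivity)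
  refine ⟨2 * (‖T‖ + 1) ^ n, κ, by positivity, hκ0, hκ1, ?_⟩
  have e1 : ∀ᶠ S in 𝓝 T, ‖S ^ n‖ < 1 / 2 :=
    ((continuous_pow n).norm.tendsto T).eventually (gt_mem_nhds hTn)
  have e2 : ∀ᶠ S in 𝓝 T, ‖S‖ < ‖T‖ + 1 :=
    (continuous_norm.tendsto T).eventually (gt_mem_nhds (lt_add_one _))
  filter_upwards [e1, e2] with S hS1 hS2
  exact norm_pow_le_of_norm_pow_le_half hn (by linarith [norm_nonneg T]) hS2.le hκ0 hκ1 hκn hS1.le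

/-- Eigenprojection of a rank one perturbation `q + P`, and the powers of the complementary part. -/
theorem pow_eq_of_rank_one_perturbation {A : Type*} [Ring A] [Algebra ℂ A] {q P R : A} {c w : ℂ}
    (hl : R * (algebraMap ℂ A c - q) = 1) (hr : (algebraMap ℂ A c - q) * R = 1)
    (hP : P * R * P = P) (hw : P * (R * R) * P = w • P) (hw0 : w ≠ 0) {N : ℕ} (hN : 1 ≤ N) :
    (q + P) ^ N = c ^ N • (w⁻¹ • (R * P * R)) + (q + P - c • (w⁻¹ • (R * P * R))) ^ N := by
  have hRq : R * q = c • R - 1 := by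
    rw [mul_sub, Algebra.algebraMap_eq_smul_one, mul_smul_comm, mul_one] at hl
    rw [← hl]; abel
  have hqR : q * R = c • R - 1 := by
    rw [sub_mul, Algebra.algebraMap_eq_smul_one, smul_mul_assoc, one_mul] at hr
    rw [← hr]; abel
  -- `(q + P) R P = c R P`, because `q R = c R - 1` and `P R P = P`. So `R P R` is a multiple of a
  -- projection onto the eigenspace, and `P R² P = w P` fixes the multiple.
  set E : A := w⁻¹ • (R * P * R) with hE
  have h1 : (q + P) * E = c • E := by
    rw [hE, mul_smul_comm, add_mul, ← mul_assoc, ← mul_assoc, ← mul_assoc, ← mul_assoc, hqR, hP,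
      sub_mul, sub_mul, one_mul, smul_mul_assoc, smul_mul_assoc, sub_add_cancel, smul_comm]
  have h2 : E * (q + P) = c • E := by
    rw [hE, smul_mul_assoc, mul_add, mul_assoc (R * P) R q, hRq, mul_assoc R P R, mul_assoc R (P * R) P,
      hP, mul_sub, mul_one, mul_smul_comm, sub_add_cancel, mul_assoc, smul_comm]
  have h3 : E * E = E := by
    have : R * P * R * (R * P * R) = R * (P * (R * R) * P) * R := by simp only [mul_assoc]
    rw [hE, smul_mul_assoc, mul_smul_comm, this, hw, mul_smul_comm, smul_mul_assoc,
      smul_smul w⁻¹ w, inv_mul_cancel₀ hw0, one_smul]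
  have h4 : ∀ n : ℕ, (q + P) ^ n * E = c ^ n • E := by
    intro n
    induction n with
    | zero => simp
    | succ n ih => rw [pow_succ, mul_assoc, h1, mul_smul_comm, ih, smul_smul, pow_succ, mul_comm c]
  clear_value E
  -- The induction starts at `1`: at `N = 0` the right side would be `E + 1`.
  induction N, hN using Nat.le_induction with
  | base => simp
  | succ n hn ih =>
    have h5 : (q + P - c • E) ^ n = (q + P) ^ n - c ^ n • E := by rw [ih]; abel
    rw [pow_succ (q + P - c • E), h5, mul_sub, sub_mul, sub_mul, mul_smul_comm, h4, smul_mul_assoc,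
      h2, smul_mul_smul_comm, h3, pow_succ, pow_succ]
    module

variable [CompleteSpace B]

theorem contDiffAt_resolvent {q : ℝ → B →L[ℂ] B} {n : ℕ} (hq : ContDiffAt ℝ n q 0)
    (h1 : IsUnit (algebraMap ℂ (B →L[ℂ] B) 1 - q 0)) :
    ContDiffAt ℝ n (fun x : ℝ × ℂ => Ring.inverse (algebraMap ℂ (B →L[ℂ] B) x.2 - q x.1)) (0, 1) := by
  obtain ⟨u, hu⟩ := h1
  have h2 : ContDiffAt ℝ n (fun x : ℝ × ℂ => algebraMap ℂ (B →L[ℂ] B) x.2 - q x.1) (0, 1) := by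
    refine ContDiffAt.sub ?_ (ContDiffAt.comp (0, 1) hq contDiffAt_fst)
    simp only [Algebra.algebraMap_eq_smul_one]
    exact contDiffAt_snd.smul contDiffAt_const
  have h3 := contDiffAt_ringInverse ℝ (n := n) u
  rw [hu] at h3
  exact ContDiffAt.comp (0, 1) h3 h2

/-- The perturbed dominant eigenvalue, as an implicit function. -/
theorem exists_implicit_eigenvalue {q : ℝ → B →L[ℂ] B} {n : ℕ} (hn : n ≠ 0) (hq : ContDiffAt ℝ n q 0)
    (h1 : IsUnit (algebraMap ℂ (B →L[ℂ] B) 1 - q 0)) {e : B} {φ : B →L[ℂ] ℂ} (hqe : q 0 e = 0)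
    (hφe : φ e = 1) :
    ∃ lam : ℝ → ℂ, ContDiffAt ℝ n lam 0 ∧ lam 0 = 1 ∧
      ∀ᶠ t in 𝓝 (0 : ℝ), φ (Ring.inverse (algebraMap ℂ (B →L[ℂ] B) (lam t) - q t) e) = 1 := by
  -- If `D (t, c) = 1`, then `(c - q t)⁻¹ e` is an eigenvector of `q t + φ ⊗ e` for `c`. Since `q 0
  -- e = 0`, `D (0, z) = z⁻¹` near `1`, so the partial derivative in `z` is `-1` and the implicit
  -- function theorem applies.
  set D : ℝ × ℂ → ℂ := fun x => φ (Ring.inverse (algebraMap ℂ (B →L[ℂ] B) x.2 - q x.1) e) with hD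
  set ev : (B →L[ℂ] B) →L[ℝ] ℂ :=
    (φ.comp (ContinuousLinearMap.apply ℂ B e)).restrictScalars ℝ with hev
  have hDc : ContDiffAt ℝ n D (0, 1) :=
    ev.contDiff.contDiffAt.comp (0, 1) (contDiffAt_resolvent hq h1)
  have hn' : ((n : ℕ∞) : WithTop ℕ∞) ≠ 0 := by exact_mod_cast hn
  have hinv : ∀ᶠ z in 𝓝 (1 : ℂ), D (0, z) = z⁻¹ := by
    have hcont : Continuous fun w : ℂ => algebraMap ℂ (B →L[ℂ] B) w - q 0 :=
      (algebraMapCLM ℂ (B →L[ℂ] B)).continuous.sub continuous_const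
    have hu : ∀ᶠ z in 𝓝 (1 : ℂ), IsUnit (algebraMap ℂ (B →L[ℂ] B) z - q 0) :=
      hcont.continuousAt.eventually (Units.isOpen.mem_nhds h1)
    filter_upwards [hu, isOpen_ne.mem_nhds (one_ne_zero (α := ℂ))] with z hz hz0
    have h2 : (algebraMap ℂ (B →L[ℂ] B) z - q 0) (z⁻¹ • e) = e := by
      simp [Algebra.algebraMap_eq_smul_one, hqe, smul_smul, inv_mul_cancel₀ hz0]
    have h3 : Ring.inverse (algebraMap ℂ (B →L[ℂ] B) z - q 0) e = z⁻¹ • e := by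
      conv_lhs => rw [← h2]
      rw [← mul_apply_eq_comp, Ring.inverse_mul_cancel _ hz, one_apply_eq_self]
    simp only [hD, h3, map_smul, hφe, smul_eq_mul, mul_one]
  have hderiv : fderiv ℝ D (0, 1) ∘L .inr ℝ ℝ ℂ = -ContinuousLinearMap.id ℝ ℂ := by
    have hf : HasFDerivAt D (fderiv ℝ D (0, 1)) (0, 1) :=
      (hDc.differentiableAt hn').hasFDerivAt
    have hin : HasFDerivAt (fun z : ℂ => ((0 : ℝ), z)) (ContinuousLinearMap.inr ℝ ℝ ℂ) 1 :=
      hasFDerivAt_prodMk_right 0 1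
    have hc := HasFDerivAt.comp (1 : ℂ) hf hin
    have hi : HasDerivAt (fun z : ℂ => z⁻¹) (-1) 1 := by
      simpa using hasDerivAt_inv (one_ne_zero (α := ℂ))
    have hi' := hi.hasFDerivAt.restrictScalars ℝ
    have := hc.unique (hi'.congr_of_eventuallyEq hinv)
    rw [this]
    ext; simp
  have hinvert : (fderiv ℝ D (0, 1) ∘L .inr ℝ ℝ ℂ).IsInvertible := by
    rw [hderiv]
    exact ⟨ContinuousLinearEquiv.neg ℝ, by ext; simp⟩
  have hD01 : D (0, 1) = 1 := by simpa using hinv.self_of_nhds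
  refine ⟨hDc.implicitFunction hn' hinvert, hDc.contDiffAt_implicitFunction hn' hinvert,
    hDc.implicitFunction_apply_self hn' hinvert, ?_⟩
  filter_upwards [hDc.eventually_apply_implicitFunction hn' hinvert] with t ht
  rw [hD01] at ht
  exact ht

/-- Nagaev–Guivarc'h: near `0` the functional `l (L t ^ N v)` is a smooth multiple of the `N`-th
power of a smooth eigenvalue, up to an exponentially small error. -/
theorem exists_eigenvalue_expansion {L : ℝ → B →L[ℂ] B} {n : ℕ} (hn : n ≠ 0)
    (hL : ContDiffAt ℝ n L 0) (hgap : HasSpectralGap (L 0)) (v : B) (l : B →L[ℂ] ℂ) :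
    ∃ (lam a : ℝ → ℂ) (C κ : ℝ), ContDiffAt ℝ n lam 0 ∧ ContDiffAt ℝ n a 0 ∧ lam 0 = 1 ∧
      0 ≤ C ∧ 0 < κ ∧ κ < 1 ∧
      ∀ᶠ t in 𝓝 (0 : ℝ), ∀ N : ℕ, 1 ≤ N → ‖l ((L t ^ N) v) - lam t ^ N * a t‖ ≤ C * κ ^ N := by
  obtain ⟨e, φ, hTe, hφT, hφe, hspec⟩ := hgap.exists_decomposition
  set P : B →L[ℂ] B := φ.smulRight e with hPdef
  set q : ℝ → B →L[ℂ] B := fun t => L t - P with hqdef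
  have hq : ContDiffAt ℝ n q 0 := hL.sub contDiffAt_const
  have h1 : IsUnit (algebraMap ℂ (B →L[ℂ] B) 1 - q 0) := by
    have : (1 : ℂ) ∉ spectrum ℂ (q 0) := fun h => by simpa using hspec h
    simpa [spectrum, resolventSet] using this
  have hqe : q 0 e = 0 := by simp [hqdef, hPdef, hTe, hφe]
  have hφq : ∀ x, φ (q 0 x) = 0 := by intro x; simp [hqdef, hPdef, hφT, hφe]
  obtain ⟨lam, hlam, hlam0, hev⟩ := exists_implicit_eigenvalue hn hq h1 hqe hφe
  set R : ℝ → B →L[ℂ] B := fun t => Ring.inverse (algebraMap ℂ (B →L[ℂ] B) (lam t) - q t) with hR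
  have hRc : ContDiffAt ℝ n R 0 := by
    have h2 : ContDiffAt ℝ n (fun t : ℝ => (t, lam t)) 0 := contDiffAt_id.prodMk hlam
    have h3 := contDiffAt_resolvent hq h1
    rw [← hlam0] at h3
    exact ContDiffAt.comp (0 : ℝ) h3 h2
  have hunit : ∀ᶠ t in 𝓝 (0 : ℝ), IsUnit (algebraMap ℂ (B →L[ℂ] B) (lam t) - q t) := by
    have hc : ContinuousAt (fun t => algebraMap ℂ (B →L[ℂ] B) (lam t) - q t) 0 :=
      ((algebraMapCLM ℂ (B →L[ℂ] B)).continuous.continuousAt.comp hlam.continuousAt).sub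
        hq.continuousAt
    refine hc.eventually (Units.isOpen.mem_nhds ?_)
    simpa only [Set.mem_ofPred_eq, hlam0] using h1
  have hR0 : R 0 e = e := by
    have h2 : (algebraMap ℂ (B →L[ℂ] B) 1 - q 0) e = e := by simp [hqe]
    simp only [hR, hlam0]
    conv_lhs => rw [← h2]
    rw [← mul_apply_eq_comp, Ring.inverse_mul_cancel _ h1, one_apply_eq_self]
  have hφR0 : ∀ x, φ (R 0 x) = φ x := by
    intro x
    have h2 : (algebraMap ℂ (B →L[ℂ] B) 1 - q 0) (R 0 x) = x := by
      simp only [hR, hlam0]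
      rw [← mul_apply_eq_comp, Ring.mul_inverse_cancel _ h1, one_apply_eq_self]
    have h3 := congrArg φ h2
    simpa [hφq] using h3
  set w : ℝ → ℂ := fun t => φ ((R t * R t) e) with hw
  have hwc : ContDiffAt ℝ n w 0 :=
    ((φ.comp (ContinuousLinearMap.apply ℂ B e)).restrictScalars ℝ).contDiff.contDiffAt.comp 0
      (hRc.mul hRc)
  have hw0 : w 0 = 1 := by simp [hw, hR0, hφe]
  set E : ℝ → B →L[ℂ] B := fun t => (w t)⁻¹ • (R t * P * R t) with hE
  have hEc : ContDiffAt ℝ n E 0 :=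
    (hwc.inv (by rw [hw0]; exact one_ne_zero)).smul ((hRc.mul contDiffAt_const).mul hRc)
  -- At `t = 0` the perturbed projection is `P` itself, so the power bound valid in a neighbourhood
  -- of `L 0 - P` carries over to small `t` by continuity.
  have hE0 : L 0 - lam 0 • E 0 = L 0 - P := by
    rw [hlam0, one_smul]
    congr 1
    ext x
    simp [hE, hw0, hPdef, hφR0, hR0]
  have hMc : ContinuousAt (fun t => L t - lam t • E t) 0 :=
    hL.continuousAt.sub (hlam.continuousAt.smul hEc.continuousAt)
  obtain ⟨C, κ, hC, hκ0, hκ1, hpow⟩ := eventually_norm_pow_le hspec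
  rw [← hE0] at hpow
  refine ⟨lam, fun t => l (E t v), ‖l‖ * C * ‖v‖, κ, hlam, ?_, hlam0, by positivity, hκ0, hκ1, ?_⟩
  · exact ((l.comp (ContinuousLinearMap.apply ℂ B v)).restrictScalars ℝ).contDiff.contDiffAt.comp 0
      hEc
  · have hwne : ∀ᶠ t in 𝓝 (0 : ℝ), w t ≠ 0 :=
      hwc.continuousAt.eventually_ne (by rw [hw0]; exact one_ne_zero)
    filter_upwards [hev, hunit, hMc.eventually hpow, hwne] with t ht1 ht2 ht3 ht4 N hN
    have hPRP : P * R t * P = P := by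
      ext x
      have : φ (R t e) = 1 := ht1
      simp [hPdef, this]
    have hPRRP : P * (R t * R t) * P = w t • P := by
      ext x
      simp [hPdef, hw, smul_smul, mul_comm]
    have : (q t + P) ^ N = lam t ^ N • E t + (q t + P - lam t • E t) ^ N :=
      pow_eq_of_rank_one_perturbation (Ring.inverse_mul_cancel _ ht2)
      (Ring.mul_inverse_cancel _ ht2) hPRP hPRRP ht4 hN
    have hqP : q t + P = L t := by simp [hqdef]
    rw [hqP] at this
    have h5 : l ((L t ^ N) v) - lam t ^ N * l (E t v) = l (((L t - lam t • E t) ^ N) v) := by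
      rw [this, add_apply, smul_apply, map_add, map_smul, smul_eq_mul, add_sub_cancel_left]
    rw [h5]
    calc _ ≤ ‖l‖ * ‖((L t - lam t • E t) ^ N) v‖ := l.le_opNorm _
      _ ≤ ‖l‖ * (‖(L t - lam t • E t) ^ N‖ * ‖v‖) := by
        gcongr; exact ContinuousLinearMap.le_opNorm _ _
      _ ≤ ‖l‖ * (C * κ ^ N * ‖v‖) := by gcongr; exact ht3 N
      _ = _ := by ring

end Perturbation

end WeakEdgeworth

namespace WeakEdgeworth

/-! ### Decay of operator powers away from the origin -/

section Decay

variable {B : Type*} [NormedAddCommGroup B] [NormedSpace ℂ B]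

/-- The bound of `eventually_norm_pow_le` is locally uniform in `t`, and finitely many
neighbourhoods cover the compact set `δ ≤ |t| ≤ K`. -/
theorem SpectrumInsideDisk.exists_norm_pow_le [CompleteSpace B] {L : ℝ → B →L[ℂ] B}
    (h : SpectrumInsideDisk L) (hL : Continuous L) {δ : ℝ} (hδ : 0 < δ) (K : ℝ) :
    ∃ C κ : ℝ, 0 ≤ C ∧ 0 < κ ∧ κ < 1 ∧
      ∀ t : ℝ, δ ≤ |t| → |t| ≤ K → ∀ N : ℕ, ‖L t ^ N‖ ≤ C * κ ^ N := by
  have hcomp : IsCompact {t : ℝ | δ ≤ |t| ∧ |t| ≤ K} := by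
    refine (isCompact_Icc (a := -K) (b := K)).of_isClosed_subset ?_ fun t ht => abs_le.1 ht.2
    exact (isClosed_le continuous_const continuous_abs).inter
      (isClosed_le continuous_abs continuous_const)
  suffices ∃ C κ : ℝ, 0 ≤ C ∧ 0 < κ ∧ κ < 1 ∧
      ∀ t ∈ {t : ℝ | δ ≤ |t| ∧ |t| ≤ K}, ∀ N : ℕ, ‖L t ^ N‖ ≤ C * κ ^ N by
    obtain ⟨C, κ, h1, h2, h3, h4⟩ := this
    exact ⟨C, κ, h1, h2, h3, fun t ht ht' => h4 t ⟨ht, ht'⟩⟩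
  refine hcomp.induction_on (p := fun s => ∃ C κ : ℝ, 0 ≤ C ∧ 0 < κ ∧ κ < 1 ∧
      ∀ t ∈ s, ∀ N : ℕ, ‖L t ^ N‖ ≤ C * κ ^ N) ?_ ?_ ?_ ?_
  · exact ⟨0, 1 / 2, le_rfl, by norm_num, by norm_num, by simp⟩
  · rintro s s' hs ⟨C, κ, h1, h2, h3, h4⟩
    exact ⟨C, κ, h1, h2, h3, fun t ht => h4 t (hs ht)⟩
  · rintro s s' ⟨C, κ, h1, h2, h3, h4⟩ ⟨C', κ', h1', h2', h3', h4'⟩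
    refine ⟨max C C', max κ κ', le_max_of_le_left h1, lt_max_of_lt_left h2, max_lt h3 h3', ?_⟩
    rintro t (ht | ht) N
    · refine (h4 t ht N).trans ?_
      gcongr <;> exact le_max_left _ _
    · refine (h4' t ht N).trans ?_
      gcongr <;> exact le_max_right _ _
  · rintro t ⟨ht, -⟩
    have ht0 : t ≠ 0 := by rintro rfl; simp at ht; linarith
    obtain ⟨C, κ, h1, h2, h3, h4⟩ := eventually_norm_pow_le (h t ht0)
    exact ⟨_, nhdsWithin_le_nhds (hL.continuousAt.eventually h4), C, κ, h1, h2, h3, fun s hs => hs⟩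

/-- Submultiplicativity upgrades the polynomial decay rate to an arbitrary one, at the price of a
constant factor in the range of frequencies. -/
theorem PolynomialDecay.exists_norm_pow_le {r₁ : ℝ} {L : ℝ → B →L[ℂ] B} (hr₁ : 0 < r₁)
    (h : PolynomialDecay r₁ L) {D : ℝ} (hD : 0 < D) :
    ∃ K c C : ℝ, 0 < K ∧ 0 < c ∧ 0 ≤ C ∧ ∀ᶠ N : ℕ in atTop, ∀ t : ℝ, K ≤ |t| →
      |t| ≤ c * (N : ℝ) ^ r₁ → ‖L t ^ N‖ ≤ C * (N : ℝ) ^ (-D) := by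
  obtain ⟨K, r₂, N₀, hK, hr₂, hN₀, hdec⟩ := h
  -- The power is cut into `k` blocks, each contributing `N ^ (-r₂)` up to a constant, so `k r₂ ≥ D`
  -- is needed.
  obtain ⟨k, hk⟩ := exists_nat_ge (D / r₂)
  rw [div_le_iff₀ hr₂] at hk
  have hk0 : 0 < k := by
    rcases Nat.eq_zero_or_pos k with rfl | hk0
    · simp at hk; linarith
    · exact hk0
  have hkR : (0 : ℝ) < k := by exact_mod_cast hk0
  -- For `M = ⌊N / k⌋ ≥ N / (2k)`, this factor turns `|t| ≤ c N ^ r₁` into `|t| ≤ M ^ r₁`, so (A4)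
  -- applies to every exponent `≥ M`, including the longer last block.
  refine ⟨K, (2 * k : ℝ) ^ (-r₁), (2 * k : ℝ) ^ D, hK, by positivity, by positivity, ?_⟩
  obtain ⟨n₀, hn₀⟩ := exists_nat_ge N₀
  filter_upwards [eventually_ge_atTop (k * (n₀ + 1))] with N hN t htK ht
  set M := N / k with hM
  have hMn : n₀ + 1 ≤ M := by rw [hM, Nat.le_div_iff_mul_le hk0]; linarith
  have hM1 : (1 : ℝ) ≤ M := by exact_mod_cast (by omega : 1 ≤ M)
  have hMN₀ : N₀ < M := by
    have : ((n₀ + 1 : ℕ) : ℝ) ≤ M := by exact_mod_cast hMn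
    push_cast at this; linarith
  have hNpos : (0 : ℝ) < N := by
    have : 0 < N := lt_of_lt_of_le (by positivity) hN
    exact_mod_cast this
  have hN2 : (N : ℝ) / (2 * k) ≤ M := by
    have h1 : N < k * (M + 1) := by
      have := Nat.div_add_mod N k
      have := Nat.mod_lt N hk0
      rw [hM]; nlinarith
    have h2 : (N : ℝ) < k * (M + 1) := by exact_mod_cast h1
    rw [div_le_iff₀ (by positivity)]
    nlinarith
  have hkM : k * M ≤ N := by rw [hM]; exact Nat.mul_div_le N k
  have hscale : ∀ p : ℝ, ((N : ℝ) / (2 * k)) ^ p = (2 * k : ℝ) ^ (-p) * (N : ℝ) ^ p := by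
    intro p
    rw [Real.div_rpow hNpos.le (by positivity), Real.rpow_neg (by positivity)]
    field_simp
  have htM : |t| ≤ (M : ℝ) ^ r₁ := by
    refine ht.trans ?_
    rw [← hscale]
    exact Real.rpow_le_rpow (by positivity) hN2 hr₁.le
  have hstep : ∀ j : ℕ, M ≤ j → ‖L t ^ j‖ ≤ (M : ℝ) ^ (-r₂) := by
    intro j hj
    have hj' : (M : ℝ) ≤ j := by exact_mod_cast hj
    refine (hdec j (hMN₀.trans_le hj') t htK
      (htM.trans (Real.rpow_le_rpow (by linarith) hj' hr₁.le))).trans ?_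
    rw [one_div, ← Real.rpow_neg (by linarith)]
    exact Real.rpow_le_rpow_of_nonpos (by linarith) hj' (by linarith)
  have hdecomp : L t ^ N = (L t ^ M) ^ (k - 1) * L t ^ (N - M * (k - 1)) := by
    rw [← pow_mul, ← pow_add]
    congr 1
    have : M * (k - 1) ≤ k * M := by rw [mul_comm]; gcongr; omega
    omega
  have hrem : M ≤ N - M * (k - 1) := by
    obtain ⟨k', rfl⟩ : ∃ k', k = k' + 1 := ⟨k - 1, by omega⟩
    rw [Nat.add_sub_cancel]
    have : (k' + 1) * M = M * k' + M := by ring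
    omega
  calc ‖L t ^ N‖ ≤ ‖(L t ^ M) ^ (k - 1)‖ * ‖L t ^ (N - M * (k - 1))‖ := by
        rw [hdecomp]; exact norm_mul_le _ _
    _ ≤ ((M : ℝ) ^ (-r₂)) ^ (k - 1) * (M : ℝ) ^ (-r₂) := by
        gcongr
        · exact opNorm_pow_le_of_le (hstep M le_rfl) _
        · exact hstep _ hrem
    _ = (M : ℝ) ^ (-(k * r₂)) := by
        rw [← pow_succ, Nat.sub_add_cancel hk0, ← Real.rpow_natCast, ← Real.rpow_mul (by linarith)]
        congr 1; ring
    _ ≤ (M : ℝ) ^ (-D) := Real.rpow_le_rpow_of_exponent_le hM1 (by linarith)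
    _ ≤ ((N : ℝ) / (2 * k)) ^ (-D) :=
        Real.rpow_le_rpow_of_nonpos (by positivity) hN2 (by linarith)
    _ = _ := by rw [hscale, neg_neg]

end Decay

end WeakEdgeworth

namespace WeakEdgeworth

open scoped FourierTransform

/-! ### Fourier inversion for test functions -/

section Fourier

theorem integrable_and_integral_norm_le_of_mem_testSpace {m k : ℕ} {f : ℝ → ℂ}
    (hf : f ∈ testSpace m k) {j : ℕ} (hj : j ≤ m) :
    Integrable (iteratedDeriv j f) ∧ ∫ x, ‖iteratedDeriv j f x‖ ≤ testNorm m k f := by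
  have hmeas : AEStronglyMeasurable (iteratedDeriv j f) volume :=
    (hf.1.continuous_iteratedDeriv j (by exact_mod_cast hj)).aestronglyMeasurable
  have hle : eLpNorm (iteratedDeriv j f) 1 volume ≤ testENorm m k f :=
    (Finset.le_sup (f := fun j => eLpNorm (iteratedDeriv j f) 1 volume)
      (Finset.mem_range.2 (Nat.lt_succ_of_le hj))).trans le_self_add
  refine ⟨memLp_one_iff_integrable.1 ⟨hmeas, hle.trans_lt hf.2⟩, ?_⟩
  rw [integral_norm_eq_lintegral_enorm hmeas, ← eLpNorm_one_eq_lintegral_enorm]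
  exact ENNReal.toReal_mono hf.2.ne hle

theorem norm_fourier_le_integral_norm (f : ℝ → ℂ) (t : ℝ) : ‖𝓕 f t‖ ≤ ∫ x, ‖f x‖ :=
  VectorFourier.norm_fourierIntegral_le_integral_norm _ _ _ _ _

theorem continuous_fourier_of_integrable {f : ℝ → ℂ} (hf : Integrable f) : Continuous (𝓕 f) :=
  VectorFourier.fourierIntegral_continuous Real.continuous_fourierChar
    (by exact continuous_inner) hf

theorem pow_mul_norm_fourier_le {m k : ℕ} {f : ℝ → ℂ} (hf : f ∈ testSpace m k) {j : ℕ} (hj : j ≤ m)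
    (t : ℝ) : |2 * Real.pi * t| ^ j * ‖𝓕 f t‖ ≤ testNorm m k f := by
  have h := Real.fourier_iteratedDeriv (N := (m : ℕ∞)) (n := j) hf.1
    (fun n hn => (integrable_and_integral_norm_le_of_mem_testSpace hf (by exact_mod_cast hn)).1)
    (by exact_mod_cast hj)
  have h2 := norm_fourier_le_integral_norm (iteratedDeriv j f) t
  rw [h] at h2
  refine le_trans (le_of_eq ?_)
    (h2.trans (integrable_and_integral_norm_le_of_mem_testSpace hf hj).2)
  rw [norm_smul, norm_pow]
  congr 2
  simp [abs_mul]

theorem norm_fourier_le {m k : ℕ} {f : ℝ → ℂ} (hm : 2 ≤ m) (hf : f ∈ testSpace m k) (t : ℝ) :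
    ‖𝓕 f t‖ ≤ 2 * testNorm m k f * (1 + t ^ 2)⁻¹ := by
  have h0 := pow_mul_norm_fourier_le hf (Nat.zero_le m) t
  have h2 := pow_mul_norm_fourier_le hf hm t
  rw [pow_zero, one_mul] at h0
  rw [sq_abs] at h2
  rw [← div_eq_mul_inv, le_div_iff₀ (by positivity)]
  have h3 : t ^ 2 ≤ (2 * Real.pi * t) ^ 2 := by
    rw [mul_pow]
    have : (1 : ℝ) ≤ (2 * Real.pi) ^ 2 := by nlinarith [Real.pi_gt_three]
    nlinarith [sq_nonneg t]
  nlinarith [norm_nonneg (𝓕 f t)]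

theorem integrable_fourier_of_mem_testSpace {m k : ℕ} {f : ℝ → ℂ} (hm : 2 ≤ m)
    (hf : f ∈ testSpace m k) : Integrable (𝓕 f) := by
  have hint : Integrable f := by
    simpa using (integrable_and_integral_norm_le_of_mem_testSpace hf (Nat.zero_le m)).1
  exact (integrable_inv_one_add_sq.const_mul (2 * testNorm m k f)).mono'
    (continuous_fourier_of_integrable hint).aestronglyMeasurable
    (Eventually.of_forall (norm_fourier_le hm hf))

theorem fourier_inversion_of_mem_testSpace {m k : ℕ} {f : ℝ → ℂ} (hm : 2 ≤ m)
    (hf : f ∈ testSpace m k) (y : ℝ) :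
    f y = ∫ t : ℝ, 𝓕 f t * Complex.exp (Complex.I * ((2 * Real.pi * t : ℝ) : ℂ) * y) := by
  have hint : Integrable f := by
    simpa using (integrable_and_integral_norm_le_of_mem_testSpace hf (Nat.zero_le m)).1
  have h := congrFun (hf.1.continuous.fourierInv_fourier_eq hint
    (integrable_fourier_of_mem_testSpace hm hf)) y
  rw [← h, Real.fourierInv_eq']
  refine integral_congr_ae (Eventually.of_forall fun t => ?_)
  simp only [smul_eq_mul]
  rw [mul_comm]
  congr 2
  simp
  ring

/-- Parseval-type formula: integrals of `f ∘ Y` against a finite complex measure are computed from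
the characteristic function of that measure. -/
theorem integral_comp_eq_integral_fourier {m k : ℕ} {f : ℝ → ℂ} (hm : 2 ≤ m)
    (hf : f ∈ testSpace m k) {Ω : Type*} [MeasurableSpace Ω] {μ : Measure Ω} [SFinite μ] {g : Ω → ℂ}
    (hg : Integrable g μ) {Y : Ω → ℝ} (hY : Measurable Y) :
    Integrable (fun t : ℝ => 𝓕 f t *
      ∫ ω, g ω * Complex.exp (Complex.I * ((2 * Real.pi * t : ℝ) : ℂ) * Y ω) ∂μ) ∧
    ∫ ω, g ω * f (Y ω) ∂μ = ∫ t : ℝ, 𝓕 f t *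
      ∫ ω, g ω * Complex.exp (Complex.I * ((2 * Real.pi * t : ℝ) : ℂ) * Y ω) ∂μ := by
  have hF := integrable_fourier_of_mem_testSpace hm hf
  have hprod : Integrable (fun z : Ω × ℝ =>
      Complex.exp (Complex.I * ((2 * Real.pi * z.2 : ℝ) : ℂ) * Y z.1) * (g z.1 * 𝓕 f z.2))
      (μ.prod volume) := by
    refine Integrable.bdd_mul (c := 1) (hg.mul_prod hF) ?_ (Eventually.of_forall fun z => ?_)
    · refine Measurable.aestronglyMeasurable ?_
      have : Measurable fun z : Ω × ℝ => Y z.1 := hY.comp measurable_fst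
      fun_prop
    · rw [mul_assoc, mul_comm, ← Complex.ofReal_mul, Complex.norm_exp_ofReal_mul_I]
  have hswap : ∀ t : ℝ, 𝓕 f t *
      ∫ ω, g ω * Complex.exp (Complex.I * ((2 * Real.pi * t : ℝ) : ℂ) * Y ω) ∂μ
      = ∫ ω, Complex.exp (Complex.I * ((2 * Real.pi * t : ℝ) : ℂ) * Y ω) * (g ω * 𝓕 f t) ∂μ := by
    intro t
    rw [← integral_const_mul]
    exact integral_congr_ae (Eventually.of_forall fun ω => by simp only; ring)
  simp only [hswap]
  refine ⟨hprod.integral_prod_right, ?_⟩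
  rw [← integral_integral_swap hprod]
  refine integral_congr_ae (Eventually.of_forall fun ω => ?_)
  simp only
  rw [fourier_inversion_of_mem_testSpace hm hf, ← integral_const_mul]
  exact integral_congr_ae (Eventually.of_forall fun ω => by simp only; ring)

/-- The contribution of an error in the characteristic function to the expectation of `f`. -/
theorem norm_integral_fourier_mul_le {q k : ℕ} {f : ℝ → ℂ} (hf : f ∈ testSpace (q + 2) k)
    {Δ : ℝ → ℂ} {g : ℝ → ℝ} {η T : ℝ} (hg : Integrable g) (hg0 : ∀ u, 0 ≤ g u) (hη : 0 ≤ η)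
    (hT : 0 < T) (hΔ : ∀ u, ‖Δ u‖ ≤ g u + η + if T < |u| then 1 else 0) :
    ‖∫ t : ℝ, 𝓕 f t * Δ (2 * Real.pi * t)‖
      ≤ testNorm (q + 2) k f * ((∫ u, g u) + 2 * Real.pi * (η + (T ^ q)⁻¹)) := by
  set M := testNorm (q + 2) k f with hM
  have hM0 : 0 ≤ M := ENNReal.toReal_nonneg
  have hpi : 0 < 2 * Real.pi := by positivity
  have hbound : ∀ t : ℝ, ‖𝓕 f t * Δ (2 * Real.pi * t)‖
      ≤ M * g (2 * Real.pi * t) + 2 * M * (η + (T ^ q)⁻¹) * (1 + t ^ 2)⁻¹ := by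
    intro t
    have h0 : ‖𝓕 f t‖ ≤ M := by
      simpa using pow_mul_norm_fourier_le hf (Nat.zero_le (q + 2)) t
    have h1 := norm_fourier_le (by omega) hf t
    -- Beyond frequency `T`, `q` of the `q + 2` derivatives yield `T ^ (-q)`; the remaining two
    -- yield the integrable weight `(1 + t²)⁻¹`.
    have h2 : ‖𝓕 f t‖ * (if T < |2 * Real.pi * t| then 1 else 0)
        ≤ 2 * M * (T ^ q)⁻¹ * (1 + t ^ 2)⁻¹ := by
      split_ifs with h
      · have ha := pow_mul_norm_fourier_le hf (Nat.le_add_right q 2) t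
        have hb := pow_mul_norm_fourier_le hf (le_refl (q + 2)) t
        rw [pow_add, sq_abs] at hb
        have hTq : T ^ q ≤ |2 * Real.pi * t| ^ q := by gcongr
        have hsq : 1 + t ^ 2 ≤ 1 + (2 * Real.pi * t) ^ 2 := by
          rw [mul_pow]
          have : (1 : ℝ) ≤ (2 * Real.pi) ^ 2 := by nlinarith [Real.pi_gt_three]
          nlinarith [sq_nonneg t]
        have hc : T ^ q * (1 + t ^ 2) * ‖𝓕 f t‖ ≤ 2 * M := by
          calc T ^ q * (1 + t ^ 2) * ‖𝓕 f t‖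
              ≤ |2 * Real.pi * t| ^ q * (1 + (2 * Real.pi * t) ^ 2) * ‖𝓕 f t‖ := by gcongr
            _ ≤ 2 * M := by nlinarith
        rw [mul_one, mul_assoc, ← mul_inv, ← div_eq_mul_inv, le_div_iff₀ (by positivity)]
        linarith
      · rw [mul_zero]; positivity
    rw [norm_mul]
    calc ‖𝓕 f t‖ * ‖Δ (2 * Real.pi * t)‖
        ≤ ‖𝓕 f t‖ * (g (2 * Real.pi * t) + η + if T < |2 * Real.pi * t| then 1 else 0) := by
          gcongr; exact hΔ _
      _ = ‖𝓕 f t‖ * g (2 * Real.pi * t) + ‖𝓕 f t‖ * η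
          + ‖𝓕 f t‖ * (if T < |2 * Real.pi * t| then 1 else 0) := by ring
      _ ≤ M * g (2 * Real.pi * t) + 2 * M * (1 + t ^ 2)⁻¹ * η
          + 2 * M * (T ^ q)⁻¹ * (1 + t ^ 2)⁻¹ := by
          gcongr
          exact hg0 _
      _ = _ := by ring
  have hi1 : Integrable fun t => M * g (2 * Real.pi * t) :=
    (hg.comp_mul_left' hpi.ne').const_mul M
  have hi2 := integrable_inv_one_add_sq.const_mul (2 * M * (η + (T ^ q)⁻¹))
  refine (norm_integral_le_of_norm_le (hi1.add hi2) (Eventually.of_forall hbound)).trans ?_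
  have hsum : ∫ t, (M * g (2 * Real.pi * t) + 2 * M * (η + (T ^ q)⁻¹) * (1 + t ^ 2)⁻¹)
      = M * (∫ t, g (2 * Real.pi * t)) + 2 * M * (η + (T ^ q)⁻¹) * Real.pi := by
    rw [integral_add hi1 hi2, integral_const_mul, integral_const_mul, integral_univ_inv_one_add_sq]
  have hscale : ∫ t, g (2 * Real.pi * t) ≤ ∫ u, g u := by
    rw [Measure.integral_comp_mul_left, smul_eq_mul]
    refine mul_le_of_le_one_left (integral_nonneg hg0) ?_
    rw [abs_of_pos (by positivity)]
    exact inv_le_one_of_one_le₀ (by linarith [Real.pi_gt_three])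
  refine hsum.trans_le ?_
  nlinarith

end Fourier

end WeakEdgeworth

namespace WeakEdgeworth

/-! ### Fourier transforms of polynomials times the Gaussian density -/

section Gaussian

theorem integrable_polynomial_mul_exp_neg_mul_sq (P : ℝ[X]) {b : ℝ} (hb : 0 < b) :
    Integrable fun x : ℝ => P.eval x * Real.exp (-b * x ^ 2) := by
  induction P using Polynomial.induction_on' with
  | add p q hp hq =>
    simp only [Polynomial.eval_add, add_mul]
    exact hp.add hq
  | monomial n a =>
    have := integrable_rpow_mul_exp_neg_mul_sq hb (s := n) (by have := Nat.cast_nonneg (α := ℝ) n; linarith)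
    simp only [Real.rpow_natCast] at this
    simpa [mul_assoc] using this.const_mul a

variable {v : ℝ≥0}

theorem integrable_polynomial_mul_gaussianPDFReal (P : ℝ[X]) (hv : 0 < v) :
    Integrable fun z : ℝ => P.eval z * gaussianPDFReal 0 v z := by
  have hv' : (0 : ℝ) < v := hv
  have := (integrable_polynomial_mul_exp_neg_mul_sq P (b := (2 * v : ℝ)⁻¹) (by positivity)).const_mul
    (√(2 * Real.pi * v))⁻¹
  refine this.congr (Eventually.of_forall fun z => ?_)
  simp only [gaussianPDFReal, sub_zero]
  rw [show -(2 * v : ℝ)⁻¹ * z ^ 2 = -z ^ 2 / (2 * v) by field_simp]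
  ring

theorem hasDerivAt_polynomial_mul_gaussianPDFReal (P : ℝ[X]) (hv : 0 < v) (z : ℝ) :
    HasDerivAt (fun z => P.eval z * gaussianPDFReal 0 v z)
      (-((Polynomial.C (v : ℝ)⁻¹ * Polynomial.X * P - Polynomial.derivative P).eval z
        * gaussianPDFReal 0 v z)) z := by
  have hv' : (0 : ℝ) < v := hv
  have h1 : HasDerivAt (fun z => gaussianPDFReal 0 v z) (-(v : ℝ)⁻¹ * z * gaussianPDFReal 0 v z) z := by
    have h2 : HasDerivAt (fun z : ℝ => -(z - 0) ^ 2 / (2 * v)) (-(v : ℝ)⁻¹ * z) z := by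
      have := (((hasDerivAt_id z).sub_const 0).pow 2).neg.div_const (2 * v : ℝ)
      convert! this using 1
      simp
      field_simp
    have := (h2.exp).const_mul (√(2 * Real.pi * v))⁻¹
    convert! this using 1
    simp only [gaussianPDFReal]
    ring
  have := (P.hasDerivAt z).mul h1
  convert! this using 1
  simp
  ring

theorem integrable_gaussian_fourier (P : ℝ[X]) (hv : 0 < v) (s : ℝ) :
    Integrable fun z : ℝ => ((P.eval z * gaussianPDFReal 0 v z : ℝ) : ℂ)
      * Complex.exp (Complex.I * s * z) := by
  have h := (integrable_polynomial_mul_gaussianPDFReal P hv).ofReal (𝕜 := ℂ)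
  refine Integrable.mono' h.norm ?_ (Eventually.of_forall fun z => ?_)
  · exact h.aestronglyMeasurable.mul (by fun_prop : Continuous fun z : ℝ =>
      Complex.exp (Complex.I * s * z)).aestronglyMeasurable
  · rw [norm_mul, mul_assoc, mul_comm Complex.I, ← Complex.ofReal_mul,
      Complex.norm_exp_ofReal_mul_I, mul_one]
    rfl

/-- Integration by parts: multiplication by `is` on the Fourier side corresponds to the Hermite-type
operator `P ↦ v⁻¹ X P - P'`, which preserves real polynomials. -/
theorem integral_gaussian_fourier_step (P : ℝ[X]) (hv : 0 < v) (s : ℝ) :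
    ∫ z : ℝ, (((Polynomial.C (v : ℝ)⁻¹ * Polynomial.X * P - Polynomial.derivative P).eval z
        * gaussianPDFReal 0 v z : ℝ) : ℂ) * Complex.exp (Complex.I * s * z)
      = (Complex.I * s) *
        ∫ z : ℝ, ((P.eval z * gaussianPDFReal 0 v z : ℝ) : ℂ) * Complex.exp (Complex.I * s * z) := by
  set Q := Polynomial.C (v : ℝ)⁻¹ * Polynomial.X * P - Polynomial.derivative P with hQ
  have hu : ∀ z : ℝ, HasDerivAt (fun z : ℝ => Complex.exp (Complex.I * s * z))
      (Complex.exp (Complex.I * s * z) * (Complex.I * s)) z := by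
    intro z
    have : HasDerivAt (fun z : ℝ => Complex.I * s * (z : ℂ)) (Complex.I * s) z := by
      simpa using (Complex.ofRealCLM.hasDerivAt (x := z)).const_mul (Complex.I * s)
    exact this.cexp
  have hv2 : ∀ z : ℝ, HasDerivAt (fun z : ℝ => ((P.eval z * gaussianPDFReal 0 v z : ℝ) : ℂ))
      ((-(Q.eval z * gaussianPDFReal 0 v z) : ℝ) : ℂ) z := fun z =>
    (hasDerivAt_polynomial_mul_gaussianPDFReal P hv z).ofReal_comp
  have i1 := integrable_gaussian_fourier Q hv s
  have i2 := integrable_gaussian_fourier P hv s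
  have := integral_mul_deriv_eq_deriv_mul_of_integrable (fun z _ => hu z) (fun z _ => hv2 z)
    (i1.neg.congr (Eventually.of_forall fun z => by
      simp only [Pi.neg_apply, Pi.mul_apply]; push_cast; ring))
    ((i2.const_mul (Complex.I * s)).congr (Eventually.of_forall fun z => by
      simp only [Pi.mul_apply]; ring))
    (i2.congr (Eventually.of_forall fun z => by simp only [Pi.mul_apply]; ring))
  rw [← integral_const_mul]
  rw [← neg_inj, ← integral_neg, ← integral_neg]
  rw [← integral_neg] at this
  refine Eq.trans (integral_congr_ae (Eventually.of_forall fun z => ?_))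
    (this.trans (integral_congr_ae (Eventually.of_forall fun z => ?_)))
  · simp only; push_cast; ring
  · simp only; ring

/-- Every real polynomial in `i s` times the Gaussian characteristic function is the Fourier
transform of a real polynomial times the Gaussian density. -/
theorem exists_polynomial_gaussian_fourier (Q : ℝ[X]) (hv : 0 < v) :
    ∃ P : ℝ[X], ∀ s : ℝ,
      ∫ z : ℝ, ((P.eval z * gaussianPDFReal 0 v z : ℝ) : ℂ) * Complex.exp (Complex.I * s * z)
        = Polynomial.aeval (Complex.I * s) Q * Complex.exp (-(v * s ^ 2 / 2 : ℝ)) := by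
  induction Q using Polynomial.induction_on with
  | C a =>
    refine ⟨Polynomial.C a, fun s => ?_⟩
    have h1 := charFun_gaussianReal (μ := 0) (v := v) s
    rw [charFun_apply_real, integral_gaussianReal_eq_integral_smul hv.ne'] at h1
    simp only [Polynomial.eval_C, Polynomial.aeval_C, Complex.coe_algebraMap]
    rw [show (-(v * s ^ 2 / 2 : ℝ) : ℂ) = s * (0 : ℝ) * Complex.I - v * s ^ 2 / 2 by
      push_cast; ring, ← h1, ← integral_const_mul]
    refine integral_congr_ae (Eventually.of_forall fun z => ?_)
    simp only [Complex.real_smul]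
    push_cast
    ring_nf
  | add p q hp hq =>
    obtain ⟨P₁, h₁⟩ := hp
    obtain ⟨P₂, h₂⟩ := hq
    refine ⟨P₁ + P₂, fun s => ?_⟩
    rw [map_add, add_mul, ← h₁, ← h₂, ← integral_add (integrable_gaussian_fourier P₁ hv s)
      (integrable_gaussian_fourier P₂ hv s)]
    refine integral_congr_ae (Eventually.of_forall fun z => ?_)
    simp only [Polynomial.eval_add]
    push_cast
    ring
  | monomial n a h =>
    obtain ⟨P, hP⟩ := h
    refine ⟨Polynomial.C (v : ℝ)⁻¹ * Polynomial.X * P - Polynomial.derivative P, fun s => ?_⟩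
    rw [integral_gaussian_fourier_step P hv s, hP]
    simp only [map_mul, map_pow, Polynomial.aeval_X, Polynomial.aeval_C]
    ring

end Gaussian

end WeakEdgeworth

namespace WeakEdgeworth

open Asymptotics
open scoped ComplexConjugate

/-! ### Constraints on the eigenvalue, and hermitian Taylor expansions -/

section Symmetry

theorem eq_zero_of_mul_pow_le {A C x κ : ℝ} (hA : 0 ≤ A) (hκ : 0 < κ) (hx : κ < x)
    (h : ∀ N : ℕ, 1 ≤ N → A * x ^ N ≤ C * κ ^ N) : A = 0 := by
  by_contra hne
  have hA' : 0 < A := lt_of_le_of_ne hA (Ne.symm hne)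
  have hlim := tendsto_pow_atTop_atTop_of_one_lt ((one_lt_div hκ).2 hx)
  obtain ⟨N, hN1, hN2⟩ := ((hlim.eventually_gt_atTop (C / A)).and (eventually_ge_atTop 1)).exists
  have := h N hN2
  rw [div_pow, div_lt_div_iff₀ hA' (by positivity)] at hN1
  linarith

/-- An exponential sequence is determined by its values up to a faster decaying error. Combining the
estimates at `N + 1` and `N` eliminates `β` and leaves `α (x - y) x ^ N`, which must then vanish. -/
theorem eq_and_eq_of_norm_pow_mul_sub_le {x y α β : ℂ} {C κ : ℝ} (hκ : 0 < κ)
    (hx : κ < ‖x‖) (hα : α ≠ 0)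
    (h : ∀ N : ℕ, 1 ≤ N → ‖x ^ N * α - y ^ N * β‖ ≤ C * κ ^ N) : x = y ∧ α = β := by
  have hxy : x = y := by
    have h1 : ‖α‖ * ‖x - y‖ = 0 := by
      refine eq_zero_of_mul_pow_le (C := C * κ + ‖y‖ * C) (by positivity) hκ hx fun N hN => ?_
      calc ‖α‖ * ‖x - y‖ * ‖x‖ ^ N = ‖α * (x - y) * x ^ N‖ := by rw [norm_mul, norm_mul, norm_pow]
        _ = ‖(x ^ (N + 1) * α - y ^ (N + 1) * β) - y * (x ^ N * α - y ^ N * β)‖ := by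
            congr 1; ring
        _ ≤ ‖x ^ (N + 1) * α - y ^ (N + 1) * β‖ + ‖y‖ * ‖x ^ N * α - y ^ N * β‖ := by
            rw [← norm_mul]; exact norm_sub_le _ _
        _ ≤ C * κ ^ (N + 1) + ‖y‖ * (C * κ ^ N) := by
            gcongr
            · exact h (N + 1) (by omega)
            · exact h N hN
        _ = _ := by ring
    rcases mul_eq_zero.1 h1 with h2 | h2
    · exact absurd (norm_eq_zero.1 h2) hα
    · exact sub_eq_zero.1 (norm_eq_zero.1 h2)
  refine ⟨hxy, ?_⟩
  have h1 : ‖α - β‖ = 0 := by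
    refine eq_zero_of_mul_pow_le (C := C) (by positivity) hκ hx fun N hN => ?_
    rw [← norm_pow, ← norm_mul]
    refine le_trans (le_of_eq ?_) (h N hN)
    rw [← hxy]; congr 1; ring
  exact sub_eq_zero.1 (norm_eq_zero.1 h1)

/-- Properties of the dominant eigenvalue and its coefficient forced by the fact that the
functions `φ N` are characteristic functions. -/
theorem eigenvalue_symmetry {φ : ℕ → ℝ → ℂ} (hφ0 : ∀ N, φ N 0 = 1) (hφ1 : ∀ N u, ‖φ N u‖ ≤ 1)
    (hφs : ∀ N u, φ N (-u) = conj (φ N u)) {lam a : ℝ → ℂ} {C κ : ℝ} (hlam : ContinuousAt lam 0)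
    (ha : ContinuousAt a 0) (hlam0 : lam 0 = 1) (hC : 0 ≤ C) (hκ0 : 0 < κ) (hκ1 : κ < 1)
    (h : ∀ᶠ u in 𝓝 (0 : ℝ), ∀ N : ℕ, 1 ≤ N → ‖φ N u - lam u ^ N * a u‖ ≤ C * κ ^ N) :
    a 0 = 1 ∧ (∀ᶠ u in 𝓝 (0 : ℝ), ‖lam u‖ ≤ 1) ∧
      (∀ᶠ u in 𝓝 (0 : ℝ), lam (-u) = conj (lam u) ∧ a (-u) = conj (a u)) := by
  have ha0 : a 0 = 1 := by
    have h0 := h.self_of_nhds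
    have h1 : ‖1 - a 0‖ = 0 := by
      refine eq_zero_of_mul_pow_le (C := C) (norm_nonneg _) hκ0 hκ1 fun N hN => ?_
      simpa [hφ0, hlam0] using h0 N hN
    exact (sub_eq_zero.1 (norm_eq_zero.1 h1)).symm
  have hane : ∀ᶠ u in 𝓝 (0 : ℝ), a u ≠ 0 := ha.eventually_ne (by rw [ha0]; exact one_ne_zero)
  have hlamκ : ∀ᶠ u in 𝓝 (0 : ℝ), κ < ‖lam u‖ :=
    hlam.norm.eventually (lt_mem_nhds (by simpa [hlam0] using hκ1))
  refine ⟨ha0, ?_, ?_⟩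
  · filter_upwards [h, hane] with u hu hau
    by_contra! hgt
    have h1 : ‖a u‖ = 0 := by
      -- The comparison rate here is `1`: as `|φ N u| ≤ 1`, the sequence `lam u ^ N * a u` is
      -- bounded, which `‖lam u‖ > 1` allows only for `a u = 0`.
      refine eq_zero_of_mul_pow_le (C := 1 + C) (norm_nonneg _) one_pos hgt fun N hN => ?_
      have h2 := hu N hN
      have h3 : ‖lam u ^ N * a u‖ ≤ ‖φ N u‖ + ‖φ N u - lam u ^ N * a u‖ := by
        have := norm_sub_le (φ N u) (φ N u - lam u ^ N * a u)
        rwa [sub_sub_cancel] at this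
      have h4 : C * κ ^ N ≤ C := mul_le_of_le_one_right hC (pow_le_one₀ hκ0.le hκ1.le)
      rw [norm_mul, norm_pow] at h3
      rw [one_pow, mul_one, mul_comm]
      linarith [hφ1 N u]
    exact hau (norm_eq_zero.1 h1)
  · have hneg : Tendsto (fun u : ℝ => -u) (𝓝 0) (𝓝 0) := by
      simpa using (continuous_neg (G := ℝ)).tendsto 0
    filter_upwards [h, hneg.eventually h, hneg.eventually hlamκ, hneg.eventually hane]
      with u hu hu' hκu hau
    refine eq_and_eq_of_norm_pow_mul_sub_le (C := 2 * C) hκ0 hκu hau fun N hN => ?_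
    have h1 := hu N hN
    have h2 := hu' N hN
    have h3 : ‖conj (φ N u - lam u ^ N * a u)‖ ≤ C * κ ^ N := by rwa [Complex.norm_conj]
    rw [map_sub, map_mul, map_pow, ← hφs] at h3
    calc _ = ‖(φ N (-u) - conj (lam u) ^ N * conj (a u)) - (φ N (-u) - lam (-u) ^ N * a (-u))‖ := by
          congr 1; ring
      _ ≤ _ := norm_sub_le _ _
      _ ≤ C * κ ^ N + C * κ ^ N := add_le_add h3 h2
      _ = _ := by ring

/-- Taylor expansion of a hermitian function: a real polynomial in `i u`. -/
theorem exists_polynomial_isLittleO {f : ℝ → ℂ} {n : ℕ} (hf : ContDiffAt ℝ n f 0)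
    (hsymm : ∀ᶠ u in 𝓝 (0 : ℝ), f (-u) = conj (f u)) :
    ∃ p : ℝ[X], (fun u : ℝ => f u - Polynomial.aeval (Complex.I * u) p) =o[𝓝 0] fun u => u ^ n := by
  obtain ⟨d, hd, hfd⟩ : ∃ d > 0, ContDiffOn ℝ n f (Metric.ball 0 d) := by
    obtain ⟨u, hu, hfu⟩ := hf.contDiffOn le_rfl (by simp)
    obtain ⟨d, hd, hsub⟩ := Metric.mem_nhds_iff.1 hu
    exact ⟨d, hd, hfu.mono hsub⟩
  obtain ⟨c, hc⟩ : ∃ c : ℕ → ℂ,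
      (fun u : ℝ => f u - ∑ k ∈ Finset.range (n + 1), c k * (u : ℂ) ^ k) =o[𝓝 0] fun u => u ^ n := by
    have := taylor_isLittleO (convex_ball (0 : ℝ) d) (Metric.mem_ball_self hd) hfd
    rw [nhdsWithin_eq_nhds.2 (Metric.ball_mem_nhds 0 hd)] at this
    refine ⟨fun k => ((k.factorial : ℝ)⁻¹ : ℝ) * iteratedDerivWithin k f (Metric.ball 0 d) 0, ?_⟩
    refine this.congr (fun u => ?_) (fun u => by rw [sub_zero])
    congr 1
    rw [taylor_within_apply]
    refine Finset.sum_congr rfl fun k _ => ?_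
    rw [Complex.real_smul]
    push_cast
    ring
  have hneg : Tendsto (fun u : ℝ => -u) (𝓝 0) (𝓝 0) := by
    simpa using (continuous_neg (G := ℝ)).tendsto 0
  have hc2 : (fun u : ℝ => f u - ∑ k ∈ Finset.range (n + 1), conj (c k) * (-(u : ℂ)) ^ k)
      =o[𝓝 0] fun u => u ^ n := by
    have h1 := hc.comp_tendsto hneg
    have h2 : (fun u : ℝ => conj (f (-u) - ∑ k ∈ Finset.range (n + 1), c k * ((-u : ℝ) : ℂ) ^ k))
        =o[𝓝 0] fun u : ℝ => (-u) ^ n := by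
      rw [← isLittleO_norm_left]
      simp only [Complex.norm_conj]
      exact h1.norm_left
    have h3 : (fun u : ℝ => (-u) ^ n) =O[𝓝 0] fun u : ℝ => u ^ n :=
      IsBigO.of_bound 1 (Eventually.of_forall fun u => by simp)
    refine (h2.trans_isBigO h3).congr' ?_ EventuallyEq.rfl
    filter_upwards [hsymm] with u hu
    simp [hu]
  -- Averaging the Taylor expansion with its conjugate at `-u` replaces each `c k / I ^ k` by its
  -- real part.
  refine ⟨∑ k ∈ Finset.range (n + 1), Polynomial.monomial k (c k / Complex.I ^ k).re, ?_⟩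
  refine ((hc.add hc2).const_mul_left (1 / 2)).congr_left fun u => ?_
  have : ∀ k, Polynomial.aeval (Complex.I * u) (Polynomial.monomial k (c k / Complex.I ^ k).re)
      = (1 / 2) * (c k * (u : ℂ) ^ k + conj (c k) * (-(u : ℂ)) ^ k) := by
    intro k
    rw [Polynomial.aeval_monomial, Complex.coe_algebraMap, Complex.re_eq_add_conj, map_div₀, map_pow,
      Complex.conj_I, mul_pow]
    have hI : Complex.I ^ k ≠ 0 := pow_ne_zero _ Complex.I_ne_zero
    have hnI : (-Complex.I) ^ k = (-1) ^ k * Complex.I ^ k := by rw [← mul_pow]; simp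
    have hnu : (-(u : ℂ)) ^ k = (-1) ^ k * (u : ℂ) ^ k := by rw [← mul_pow]; simp
    have h1 : ((-1 : ℂ) ^ k) * (-1) ^ k = 1 := by rw [← mul_pow]; simp
    have h1' : (-1 : ℂ) ^ k ≠ 0 := pow_ne_zero _ (by simp)
    rw [hnI, hnu]
    field_simp
    linear_combination (-1 : ℂ) * conj (c k) * (u : ℂ) ^ k * h1
  rw [map_sum, Finset.sum_congr rfl fun k _ => this k, ← Finset.mul_sum, Finset.sum_add_distrib]
  ring

end Symmetry

end WeakEdgeworth

namespace WeakEdgeworth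

open Asymptotics
open scoped ComplexConjugate

/-! ### Expansion of the logarithm of the eigenvalue -/

section Expansion

theorem tendsto_aeval_I_mul_zero {τ : ℝ[X]} (hτ : τ.coeff 0 = 0) :
    Tendsto (fun u : ℝ => Polynomial.aeval (Complex.I * u) τ) (𝓝 0) (𝓝 0) := by
  have hc : Continuous fun u : ℝ => Polynomial.aeval (Complex.I * u) τ := by
    have := τ.continuous_aeval (A := ℂ)
    exact this.comp (by fun_prop)
  have := hc.tendsto 0
  simpa [Polynomial.aeval_def, Polynomial.eval₂_at_zero, hτ] using this

theorem pow_add_two_isBigO_sq (n : ℕ) :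
    (fun u : ℝ => u ^ (n + 2)) =O[𝓝 0] fun u : ℝ => u ^ 2 := by
  refine IsBigO.of_bound 1 ?_
  filter_upwards [Metric.ball_mem_nhds (0 : ℝ) one_pos] with u hu
  rw [Metric.mem_ball, dist_zero_right] at hu
  rw [one_mul, norm_pow, norm_pow]
  exact pow_le_pow_of_le_one (norm_nonneg _) hu.le (by omega)

/-- `A` and `v` are read off the coefficients of `iu` and `(iu)²` in the Taylor polynomial of `log
lam`, which are real by symmetry. The sign of `v` comes from `‖lam‖ ≤ 1`, and `τ` collects the
higher terms. -/
theorem exists_log_expansion {lam : ℝ → ℂ} {n : ℕ} (hlam : ContDiffAt ℝ (n + 2 : ℕ) lam 0)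
    (hlam0 : lam 0 = 1) (hle : ∀ᶠ u in 𝓝 (0 : ℝ), ‖lam u‖ ≤ 1)
    (hsymm : ∀ᶠ u in 𝓝 (0 : ℝ), lam (-u) = conj (lam u)) :
    ∃ (A : ℝ) (v : ℝ≥0) (τ : ℝ[X]), τ.coeff 0 = 0 ∧
      (fun u : ℝ => Complex.log (lam u) - (Complex.I * u * A - v * (u : ℂ) ^ 2 / 2
        - (u : ℂ) ^ 2 * Polynomial.aeval (Complex.I * u) τ)) =o[𝓝 0] fun u => u ^ (n + 2) := by
  have hslit : ∀ᶠ u in 𝓝 (0 : ℝ), lam u ∈ Complex.slitPlane :=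
    hlam.continuousAt.eventually (Complex.isOpen_slitPlane.mem_nhds (by
      rw [hlam0]; exact Complex.one_mem_slitPlane))
  have hg : ContDiffAt ℝ (n + 2 : ℕ) (fun u => Complex.log (lam u)) 0 := by
    have h1 : ContDiffAt ℂ (n + 2 : ℕ) Complex.log (lam 0) :=
      Complex.contDiffAt_log (by rw [hlam0]; exact Complex.one_mem_slitPlane)
    exact ContDiffAt.comp 0 (h1.restrict_scalars ℝ) hlam
  obtain ⟨p, hp⟩ := exists_polynomial_isLittleO hg (by
    filter_upwards [hsymm, hslit] with u hu hu'
    rw [hu, Complex.log_conj _ (Complex.mem_slitPlane_iff_arg.1 hu').1])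
  have hp0 : p.coeff 0 = 0 := by
    have h0 := (isLittleO_iff.1 hp one_pos).self_of_nhds
    have h1 : Complex.log (lam 0) - Polynomial.aeval (Complex.I * (0 : ℝ)) p = 0 := by
      simpa using h0
    rw [hlam0] at h1
    simpa [Polynomial.aeval_def, Polynomial.eval₂_at_zero, ← Polynomial.coeff_zero_eq_eval_zero]
      using h1
  set p₁ := p.divX with hp₁
  set p₂ := p₁.divX with hp₂
  have hpe : p = Polynomial.X * (Polynomial.C (p.coeff 1)
      + Polynomial.X * (Polynomial.C (p.coeff 2) + Polynomial.X * p₂.divX)) := by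
    have e1 : p = p₁ * Polynomial.X + Polynomial.C (p.coeff 0) := (Polynomial.divX_mul_X_add p).symm
    have e2 : p₁ = p₂ * Polynomial.X + Polynomial.C (p₁.coeff 0) :=
      (Polynomial.divX_mul_X_add p₁).symm
    have e3 : p₂ = p₂.divX * Polynomial.X + Polynomial.C (p₂.coeff 0) :=
      (Polynomial.divX_mul_X_add p₂).symm
    have c1 : p₁.coeff 0 = p.coeff 1 := by rw [hp₁, Polynomial.coeff_divX]
    have c2 : p₂.coeff 0 = p.coeff 2 := by rw [hp₂, hp₁, Polynomial.coeff_divX, Polynomial.coeff_divX]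
    rw [hp0, map_zero, add_zero] at e1
    rw [c1] at e2
    rw [c2] at e3
    rw [e2] at e1
    rw [e3] at e1
    conv_lhs => rw [e1]
    ring
  set τ := Polynomial.X * p₂.divX with hτ
  have hτ0 : τ.coeff 0 = 0 := by simp [hτ]
  have hval : ∀ u : ℝ, Polynomial.aeval (Complex.I * u) p = Complex.I * u * (p.coeff 1 : ℝ)
      - ((p.coeff 2 : ℝ) : ℂ) * (u : ℂ) ^ 2 - (u : ℂ) ^ 2 * Polynomial.aeval (Complex.I * u) τ := by
    intro u
    conv_lhs => rw [hpe]
    simp only [map_mul, map_add, Polynomial.aeval_X, Polynomial.aeval_C, Complex.coe_algebraMap]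
    linear_combination ((p.coeff 2 : ℂ) * u ^ 2 + u ^ 2 * Polynomial.aeval (Complex.I * u) τ)
      * Complex.I_sq
  -- A negative coefficient would make `Re log lam` positive at small `u ≠ 0`: each of the two error
  -- terms costs at most a quarter of the leading term.
  have hc2 : 0 ≤ p.coeff 2 := by
    have h1 : (fun u : ℝ => Complex.log (lam u) - Polynomial.aeval (Complex.I * u) p)
        =o[𝓝 0] fun u => u ^ 2 := by
      exact hp.trans_isBigO (pow_add_two_isBigO_sq n)
    have hτlim := tendsto_aeval_I_mul_zero hτ0
    by_contra! hneg
    have hτsmall : ∀ᶠ u : ℝ in 𝓝 0, ‖Polynomial.aeval (Complex.I * u) τ‖ < -p.coeff 2 / 4 := by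
      have := hτlim.norm
      rw [norm_zero] at this
      exact this.eventually (gt_mem_nhds (by linarith))
    have hev := ((isLittleO_iff.1 h1 (show 0 < -p.coeff 2 / 4 by linarith)).and
      (hτsmall.and (hle.and hslit)))
    have hev' : ∀ᶠ u in 𝓝[≠] (0 : ℝ), _ := nhdsWithin_le_nhds hev
    obtain ⟨u, ⟨hu1, hu2, hu3, hu4⟩, hu0⟩ := (hev'.and self_mem_nhdsWithin).exists
    have hu0 : u ≠ 0 := hu0
    have hre : (Complex.log (lam u)).re ≤ 0 := by
      rw [Complex.log_re]
      exact Real.log_nonpos (norm_nonneg _) hu3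
    have h2 : (Complex.log (lam u)).re = -(p.coeff 2) * u ^ 2
        - u ^ 2 * (Polynomial.aeval (Complex.I * u) τ).re
        + (Complex.log (lam u) - Polynomial.aeval (Complex.I * u) p).re := by
      rw [Complex.sub_re, hval u]
      simp [← Complex.ofReal_pow]
    have h3 := (Complex.abs_re_le_norm (Polynomial.aeval (Complex.I * (u : ℂ)) τ))
    have h4 := (Complex.abs_re_le_norm (Complex.log (lam u) - Polynomial.aeval (Complex.I * u) p))
    have h5 : 0 < u ^ 2 := by positivity
    rw [norm_pow, Real.norm_eq_abs, sq_abs] at hu1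
    have h6 := abs_le.1 (h3.trans hu2.le)
    have h7 := abs_le.1 (h4.trans hu1)
    nlinarith
  obtain ⟨v, hv⟩ : ∃ v : ℝ≥0, (v : ℝ) = 2 * p.coeff 2 := ⟨⟨2 * p.coeff 2, by linarith⟩, rfl⟩
  refine ⟨p.coeff 1, v, τ, hτ0, ?_⟩
  refine hp.congr_left fun u => ?_
  rw [hval u]
  rw [hv]
  push_cast
  ring

theorem isLittleO_sq_of_log_expansion {g : ℝ → ℂ} {A : ℝ} {v : ℝ≥0} {τ : ℝ[X]} {n : ℕ}
    (hτ : τ.coeff 0 = 0)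
    (h : (fun u : ℝ => g u - (Complex.I * u * A - v * (u : ℂ) ^ 2 / 2
        - (u : ℂ) ^ 2 * Polynomial.aeval (Complex.I * u) τ)) =o[𝓝 0] fun u => u ^ (n + 2)) :
    (fun u : ℝ => g u - (Complex.I * u * A - v * (u : ℂ) ^ 2 / 2)) =o[𝓝 0] fun u => u ^ 2 := by
  have h1 : (fun u : ℝ => (u : ℂ) ^ 2 * Polynomial.aeval (Complex.I * u) τ)
      =o[𝓝 0] fun u : ℝ => u ^ 2 * (1 : ℝ) :=
    IsBigO.mul_isLittleO (IsBigO.of_bound 1 (by simp))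
      ((isLittleO_one_iff ℝ).2 (tendsto_aeval_I_mul_zero hτ))
  simp only [mul_one] at h1
  refine ((h.trans_isBigO (pow_add_two_isBigO_sq n)).sub h1).congr_left fun u => ?_
  ring

theorem exists_norm_aeval_sub_sum_le (p : ℝ[X]) (n : ℕ) :
    ∃ C : ℝ, 0 ≤ C ∧ ∀ u : ℝ, |u| ≤ 1 →
      ‖Polynomial.aeval (Complex.I * u) p
        - ∑ j ∈ Finset.range n, (p.coeff j : ℂ) * (Complex.I * u) ^ j‖ ≤ C * |u| ^ n := by
  refine ⟨∑ j ∈ Finset.range (p.natDegree + 1), |p.coeff (n + j)|,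
    Finset.sum_nonneg fun _ _ => abs_nonneg _, fun u hu => ?_⟩
  rw [Polynomial.aeval_eq_sum_range' (show p.natDegree < n + (p.natDegree + 1) by omega),
    Finset.sum_range_add]
  simp only [Complex.real_smul, add_sub_cancel_left]
  refine (norm_sum_le _ _).trans ?_
  rw [Finset.sum_mul]
  refine Finset.sum_le_sum fun j _ => ?_
  rw [norm_mul, norm_pow, norm_mul, Complex.norm_I, one_mul, Complex.norm_real, Complex.norm_real,
    Real.norm_eq_abs, Real.norm_eq_abs]
  gcongr _ * ?_
  exact pow_le_pow_of_le_one (abs_nonneg _) hu (Nat.le_add_right n j)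

end Expansion

end WeakEdgeworth

namespace WeakEdgeworth

open Asymptotics

/-! ### Edgeworth expansion of the characteristic function near zero -/

section LocalExpansion

/-- The four terms are the four sources of error: the remainder `d` in the exponent, the truncated
exponential series, the replacement of `a` by its Taylor polynomial `b`, and the truncation of each
coefficient polynomial. -/
theorem norm_exp_mul_sub_sum_le (x d a b : ℂ) (n : ℕ) (s : ℕ → ℂ) :
    ‖Complex.exp (x + d) * a - ∑ k ∈ Finset.range n, s k‖
      ≤ ‖d‖ * Real.exp (‖x‖ + ‖d‖) * ‖a‖ + ‖x‖ ^ n * Real.exp ‖x‖ * ‖a‖ + Real.exp ‖x‖ * ‖a - b‖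
        + ∑ k ∈ Finset.range n, ‖x ^ k / k.factorial * b - s k‖ := by
  set S := ∑ k ∈ Finset.range n, x ^ k / (k.factorial : ℂ) with hS
  have hSle : ‖S‖ ≤ Real.exp ‖x‖ := by
    refine (norm_sum_le _ _).trans ?_
    refine le_trans (le_of_eq ?_) (Real.sum_le_exp_of_nonneg (norm_nonneg x) n)
    refine Finset.sum_congr rfl fun k _ => ?_
    simp
  have h1 : ‖Complex.exp (x + d) - Complex.exp x‖ ≤ ‖d‖ * Real.exp (‖x‖ + ‖d‖) := by
    have h := Complex.norm_exp_sub_sum_le_norm_mul_exp d 1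
    simp only [Finset.range_one, Finset.sum_singleton, pow_zero, Nat.factorial_zero, Nat.cast_one,
      div_one, pow_one] at h
    have : Complex.exp (x + d) - Complex.exp x = Complex.exp x * (Complex.exp d - 1) := by
      rw [Complex.exp_add]; ring
    rw [this, norm_mul, Real.exp_add]
    calc _ ≤ Real.exp ‖x‖ * (‖d‖ * Real.exp ‖d‖) := by
          gcongr; exact Complex.norm_exp_le_exp_norm x
      _ = _ := by ring
  have h2 := Complex.norm_exp_sub_sum_le_norm_mul_exp x n
  have hdec : Complex.exp (x + d) * a - ∑ k ∈ Finset.range n, s k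
      = (Complex.exp (x + d) - Complex.exp x) * a + (Complex.exp x - S) * a + S * (a - b)
        + ∑ k ∈ Finset.range n, (x ^ k / k.factorial * b - s k) := by
    rw [Finset.sum_sub_distrib, ← Finset.sum_mul, ← hS]; ring
  rw [hdec]
  refine (norm_add_le _ _).trans (add_le_add ((norm_add₃_le).trans ?_) (norm_sum_le _ _))
  rw [norm_mul, norm_mul, norm_mul]
  gcongr

set_option maxHeartbeats 1000000 in
/-- The Edgeworth expansion of the characteristic function near the origin. -/
theorem local_edgeworth {lam a : ℝ → ℂ} {A : ℝ} {v : ℝ≥0} (hv : 0 < v) {τ α : ℝ[X]} {r : ℕ}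
    (hτ : τ.coeff 0 = 0) (hlam : ContinuousAt lam 0) (hlam0 : lam 0 = 1)
    (hlog : (fun u : ℝ => Complex.log (lam u) - (Complex.I * u * A - v * (u : ℂ) ^ 2 / 2
        - (u : ℂ) ^ 2 * Polynomial.aeval (Complex.I * u) τ)) =o[𝓝 0] fun u => u ^ (r + 2))
    (hac : ContinuousAt a 0) (ha0 : a 0 = 1)
    (ha : (fun u : ℝ => a u - Polynomial.aeval (Complex.I * u) α) =o[𝓝 0] fun u => u ^ r)
    {ε : ℝ} (hε : 0 < ε) :
    ∀ᶠ u in 𝓝 (0 : ℝ), ∀ N : ℕ,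
      ‖lam u ^ N * a u * Complex.exp (-(Complex.I * u * (N * A)))
        - Complex.exp (-(v * (N * u ^ 2) / 2 : ℝ)) * ∑ k ∈ Finset.range (r + 1),
          (-(N * (u : ℂ) ^ 2)) ^ k / k.factorial *
            ∑ j ∈ Finset.range (r + 1), ((τ ^ k * α).coeff j : ℂ) * (Complex.I * u) ^ j‖
      ≤ ε * |u| ^ r * (1 + N * u ^ 2) ^ (r + 1) * Real.exp (-(v / 4 * (N * u ^ 2))) := by
  have hv' : (0 : ℝ) < v := hv
  obtain ⟨Cτ, hCτ, hτb⟩ := exists_norm_aeval_sub_sum_le τ 1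
  choose C hC hCb using fun k => exists_norm_aeval_sub_sum_le (τ ^ k * α) (r + 1)
  -- `ε / 8` makes the contribution of `d` small. `v / 8` gives `‖d‖ ≤ v y / 8`; with the same bound
  -- for `x`, the exponentials cost at most `exp (v y / 4)`, half of the Gaussian exponent.
  set e₁ := min (ε / 8) (v / 8) with he₁
  have he₁0 : 0 < e₁ := lt_min (by linarith) (by linarith)
  have hsmall : ∀ K : ℝ, ∀ η > 0, ∀ᶠ u in 𝓝 (0 : ℝ), K * |u| ≤ η := by
    intro K η hη
    have : Tendsto (fun u : ℝ => K * |u|) (𝓝 0) (𝓝 (K * |0|)) :=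
      (continuous_const.mul continuous_abs).tendsto 0
    rw [abs_zero, mul_zero] at this
    exact (this.eventually (gt_mem_nhds hη)).mono fun u hu => hu.le
  have hne : ∀ᶠ u in 𝓝 (0 : ℝ), lam u ≠ 0 :=
    hlam.eventually_ne (by rw [hlam0]; exact one_ne_zero)
  have ha2 : ∀ᶠ u in 𝓝 (0 : ℝ), ‖a u‖ < 2 :=
    hac.norm.eventually (gt_mem_nhds (by simp [ha0]))
  filter_upwards [isLittleO_iff.1 hlog he₁0, isLittleO_iff.1 ha (show 0 < ε / 8 by linarith), hne,
    ha2, hsmall 1 1 one_pos, hsmall Cτ (v / 8) (by linarith), hsmall (Cτ ^ (r + 1)) (ε / 8)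
    (by linarith), hsmall (∑ k ∈ Finset.range (r + 1), C k) (ε / 8) (by linarith)]
    with u h1 h2 h3 h4 h5 h6 h7 h8 N
  rw [one_mul] at h5
  set y : ℝ := N * u ^ 2 with hy
  have hy0 : 0 ≤ y := by positivity
  set t := Polynomial.aeval (Complex.I * (u : ℂ)) τ with ht
  set b := Polynomial.aeval (Complex.I * (u : ℂ)) α with hb
  set err := Complex.log (lam u) - (Complex.I * u * A - v * (u : ℂ) ^ 2 / 2 - (u : ℂ) ^ 2 * t)
    with herr
  have ht' : ‖t‖ ≤ Cτ * |u| := by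
    have := hτb u h5
    simpa [hτ] using this
  set x : ℂ := -(y : ℂ) * t with hx
  set d : ℂ := N * err with hd
  have hxn : ‖x‖ ≤ y * (Cτ * |u|) := by
    rw [hx, norm_mul, norm_neg, Complex.norm_real, Real.norm_of_nonneg hy0]
    gcongr
  -- `N * o(u ^ (r + 2))` is `N u²` times `o(u ^ r)`: this is where the eigenvalue uses two more
  -- derivatives than the coefficient `a`.
  have hdn : ‖d‖ ≤ e₁ * |u| ^ r * y := by
    rw [hd, norm_mul, Complex.norm_natCast]
    rw [norm_pow, Real.norm_eq_abs] at h1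
    calc (N : ℝ) * ‖err‖ ≤ N * (e₁ * |u| ^ (r + 2)) := by gcongr
      _ = _ := by rw [hy, ← sq_abs u]; ring
  have hxv : ‖x‖ ≤ v / 8 * y := by
    refine hxn.trans ?_
    rw [mul_comm]
    gcongr
  have hur : |u| ^ r ≤ 1 := pow_le_one₀ (abs_nonneg u) h5
  have hdv : ‖d‖ ≤ v / 8 * y := by
    refine hdn.trans ?_
    have : e₁ * |u| ^ r ≤ v / 8 :=
      (mul_le_of_le_one_right he₁0.le hur).trans (min_le_right _ _)
    gcongr
  have hmain : lam u ^ N * a u * Complex.exp (-(Complex.I * u * (N * A)))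
      = Complex.exp (-(v * y / 2 : ℝ)) * (Complex.exp (x + d) * a u) := by
    have : lam u ^ N = Complex.exp (N * Complex.log (lam u)) := by
      rw [Complex.exp_nat_mul, Complex.exp_log h3]
    rw [this, mul_right_comm, ← Complex.exp_add, ← mul_assoc (Complex.exp _) _ (a u),
      ← Complex.exp_add]
    congr 2
    rw [hx, hd, herr, hy]
    push_cast
    ring
  rw [hmain, ← mul_sub, norm_mul, Complex.norm_exp]
  have hre : (-(v * y / 2 : ℝ) : ℂ).re = -(v * y / 2) := by
    rw [← Complex.ofReal_neg, Complex.ofReal_re]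
  rw [hre]
  set E := Real.exp (v / 4 * y) with hE
  have hE1 : 1 ≤ E := Real.one_le_exp (by positivity)
  have hexpx : Real.exp ‖x‖ ≤ E := Real.exp_le_exp.2 (by nlinarith)
  have hexpxd : Real.exp (‖x‖ + ‖d‖) ≤ E := Real.exp_le_exp.2 (by nlinarith)
  have hone : (1 : ℝ) ≤ 1 + y := by linarith
  have hyk : ∀ k ≤ r + 1, y ^ k ≤ (1 + y) ^ (r + 1) := fun k hk =>
    (pow_le_pow_left₀ hy0 (by linarith) k).trans (pow_le_pow_right₀ hone hk)
  set W := (1 + y) ^ (r + 1) with hW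
  have hW1 : 1 ≤ W := one_le_pow₀ hone
  set U := |u| ^ r with hU
  have hU0 : 0 ≤ U := by positivity
  have hbound := norm_exp_mul_sub_sum_le x d (a u) b (r + 1) fun k =>
    (-(N * (u : ℂ) ^ 2)) ^ k / k.factorial *
      ∑ j ∈ Finset.range (r + 1), ((τ ^ k * α).coeff j : ℂ) * (Complex.I * u) ^ j
  have t1 : ‖d‖ * Real.exp (‖x‖ + ‖d‖) * ‖a u‖ ≤ ε / 4 * (U * W * E) := by
    have hy1 : y ≤ W := by simpa using hyk 1 (by omega)
    calc ‖d‖ * Real.exp (‖x‖ + ‖d‖) * ‖a u‖ ≤ (e₁ * U * y) * E * 2 := by gcongr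
      _ ≤ (ε / 8 * U * W) * E * 2 := by gcongr; exact min_le_left _ _
      _ = _ := by ring
  have t2 : ‖x‖ ^ (r + 1) * Real.exp ‖x‖ * ‖a u‖ ≤ ε / 4 * (U * W * E) := by
    calc ‖x‖ ^ (r + 1) * Real.exp ‖x‖ * ‖a u‖ ≤ (y * (Cτ * |u|)) ^ (r + 1) * E * 2 := by gcongr
      _ = y ^ (r + 1) * (Cτ ^ (r + 1) * |u|) * U * E * 2 := by rw [hU]; ring
      _ ≤ W * (ε / 8) * U * E * 2 := by gcongr; exact hyk _ le_rfl
      _ = _ := by ring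
  have t3 : Real.exp ‖x‖ * ‖a u - b‖ ≤ ε / 8 * (U * W * E) := by
    rw [norm_pow, Real.norm_eq_abs] at h2
    calc Real.exp ‖x‖ * ‖a u - b‖ ≤ E * (ε / 8 * U) := by gcongr
      _ ≤ E * (ε / 8 * U) * W := le_mul_of_one_le_right (by positivity) hW1
      _ = _ := by ring
  have t4 : ∑ k ∈ Finset.range (r + 1), ‖x ^ k / k.factorial * b
      - (-(N * (u : ℂ) ^ 2)) ^ k / k.factorial *
      ∑ j ∈ Finset.range (r + 1), ((τ ^ k * α).coeff j : ℂ) * (Complex.I * u) ^ j‖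
      ≤ ε / 8 * (U * W * E) := by
    have hk : ∀ k ∈ Finset.range (r + 1), ‖x ^ k / k.factorial * b
        - (-(N * (u : ℂ) ^ 2)) ^ k / k.factorial *
        ∑ j ∈ Finset.range (r + 1), ((τ ^ k * α).coeff j : ℂ) * (Complex.I * u) ^ j‖
        ≤ C k * (W * |u| ^ (r + 1)) := by
      intro k hk
      have hk' : k ≤ r + 1 := by have := Finset.mem_range.1 hk; omega
      have e : x ^ k / k.factorial * b - (-(N * (u : ℂ) ^ 2)) ^ k / k.factorial *
          ∑ j ∈ Finset.range (r + 1), ((τ ^ k * α).coeff j : ℂ) * (Complex.I * u) ^ j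
          = (-(y : ℂ)) ^ k / k.factorial * (Polynomial.aeval (Complex.I * u) (τ ^ k * α)
            - ∑ j ∈ Finset.range (r + 1), ((τ ^ k * α).coeff j : ℂ) * (Complex.I * u) ^ j) := by
        rw [map_mul, map_pow, ← ht, ← hb, hx, hy]
        push_cast
        ring
      rw [e, norm_mul, norm_div, norm_pow, norm_neg, Complex.norm_real, Real.norm_of_nonneg hy0,
        Complex.norm_natCast]
      have hfac : y ^ k / k.factorial ≤ W := by
        refine (div_le_self (by positivity) ?_).trans (hyk k hk')
        exact_mod_cast Nat.one_le_iff_ne_zero.2 (Nat.factorial_ne_zero k)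
      calc _ ≤ W * (C k * |u| ^ (r + 1)) := by
            gcongr
            exact hCb k u h5
        _ = _ := by ring
    refine (Finset.sum_le_sum hk).trans ?_
    rw [← Finset.sum_mul]
    calc (∑ k ∈ Finset.range (r + 1), C k) * (W * |u| ^ (r + 1))
        = ((∑ k ∈ Finset.range (r + 1), C k) * |u|) * (U * W) := by rw [hU]; ring
      _ ≤ ε / 8 * (U * W) := by gcongr
      _ ≤ ε / 8 * (U * W) * E := le_mul_of_one_le_right (by positivity) hE1
      _ = _ := by ring
  have htotal := hbound.trans (add_le_add (add_le_add (add_le_add t1 t2) t3) t4)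
  calc _ ≤ Real.exp (-(v * y / 2)) * (ε / 4 * (U * W * E) + ε / 4 * (U * W * E)
        + ε / 8 * (U * W * E) + ε / 8 * (U * W * E)) := by gcongr
    _ ≤ Real.exp (-(v * y / 2)) * (ε * (U * W * E)) := by
        gcongr
        have : 0 ≤ U * W * E := by positivity
        nlinarith
    _ = ε * U * W * (Real.exp (-(v * y / 2)) * E) := by ring
    _ = ε * U * W * Real.exp (-(v / 4 * y)) := by
        rw [hE, ← Real.exp_add]; congr 2; ring

end LocalExpansion

end WeakEdgeworth

namespace WeakEdgeworth

open Asymptotics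
open scoped FourierTransform

/-! ### The Edgeworth sum and its polynomials -/

section EdgeworthSum

/-- The Fourier side of the Edgeworth expansion of order `r`. -/
noncomputable def edgeworthSum (v : ℝ≥0) (τ α : ℝ[X]) (r N : ℕ) (u : ℝ) : ℂ :=
  Complex.exp (-(v * (N * u ^ 2) / 2 : ℝ)) * ∑ k ∈ Finset.range (r + 1),
    (-(N * (u : ℂ) ^ 2)) ^ k / k.factorial *
      ∑ j ∈ Finset.range (r + 1), ((τ ^ k * α).coeff j : ℂ) * (Complex.I * u) ^ j

theorem exists_pow_le_exp {b : ℝ} (hb : 0 < b) (m : ℕ) :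
    ∃ C : ℝ, 0 ≤ C ∧ ∀ y : ℝ, 0 ≤ y → (1 + y) ^ m ≤ C * Real.exp (b * y) := by
  refine ⟨m.factorial * (b ^ m)⁻¹ * Real.exp b, by positivity, fun y hy => ?_⟩
  have h := Real.pow_div_factorial_le_exp (b * (1 + y)) (by positivity) m
  rw [div_le_iff₀ (by positivity), mul_pow, mul_add, mul_one, Real.exp_add] at h
  have hbm : 0 < b ^ m := by positivity
  calc (1 + y) ^ m = (b ^ m)⁻¹ * (b ^ m * (1 + y) ^ m) := by field_simp
    _ ≤ (b ^ m)⁻¹ * (Real.exp b * Real.exp (b * y) * m.factorial) := by gcongr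
    _ = _ := by ring

/-- Half of the Gaussian exponent absorbs the polynomial factors. For `|u| ≥ δ` the remaining half
makes the Edgeworth sum exponentially small in `N`. -/
theorem exists_norm_edgeworthSum_le {v : ℝ≥0} (hv : 0 < v) (τ α : ℝ[X]) (r : ℕ) :
    ∃ C : ℝ, 0 ≤ C ∧ ∀ N : ℕ, 1 ≤ N → ∀ u : ℝ,
      ‖edgeworthSum v τ α r N u‖ ≤ C * Real.exp (-(v / 4 * (N * u ^ 2))) := by
  have hv' : (0 : ℝ) < v := hv
  obtain ⟨C, hC, hCb⟩ := exists_pow_le_exp (b := (v / 4 : ℝ)) (by positivity) (r + r)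
  set M := ∑ k ∈ Finset.range (r + 1), ∑ j ∈ Finset.range (r + 1), |(τ ^ k * α).coeff j| with hM
  have hM0 : 0 ≤ M := Finset.sum_nonneg fun _ _ => Finset.sum_nonneg fun _ _ => abs_nonneg _
  refine ⟨M * C, by positivity, fun N hN u => ?_⟩
  have hN' : (1 : ℝ) ≤ N := by exact_mod_cast hN
  rw [edgeworthSum, norm_mul, Complex.norm_exp]
  set y : ℝ := N * u ^ 2 with hy
  have hy0 : 0 ≤ y := by positivity
  have hre : (-(v * y / 2 : ℝ) : ℂ).re = -(v * y / 2) := by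
    rw [← Complex.ofReal_neg, Complex.ofReal_re]
  have hu : |u| ≤ 1 + y := by
    have : u ^ 2 ≤ y := le_mul_of_one_le_left (sq_nonneg u) hN'
    rw [← sq_abs] at this
    nlinarith [sq_nonneg (|u| - 1)]
  have hpow : ∀ k ∈ Finset.range (r + 1), ∀ z : ℝ, 0 ≤ z → z ≤ 1 + y → z ^ k ≤ (1 + y) ^ r :=
    fun k hk z hz hzy => (pow_le_pow_left₀ hz hzy k).trans
      (pow_le_pow_right₀ (by linarith) (by have := Finset.mem_range.1 hk; omega))
  have hsum : ‖∑ k ∈ Finset.range (r + 1), (-(N * (u : ℂ) ^ 2)) ^ k / k.factorial *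
      ∑ j ∈ Finset.range (r + 1), ((τ ^ k * α).coeff j : ℂ) * (Complex.I * u) ^ j‖
      ≤ M * (1 + y) ^ (r + r) := by
    rw [hM, Finset.sum_mul]
    refine norm_sum_le_of_le _ fun k hk => ?_
    have e1 : ‖(-(N * (u : ℂ) ^ 2)) ^ k / (k.factorial : ℂ)‖ ≤ (1 + y) ^ r := by
      rw [norm_div, norm_pow, norm_neg, Complex.norm_natCast]
      have : ‖(N : ℂ) * (u : ℂ) ^ 2‖ = y := by
        rw [norm_mul, norm_pow, Complex.norm_natCast, Complex.norm_real, Real.norm_eq_abs, sq_abs]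
      rw [this]
      refine (div_le_self (by positivity) ?_).trans (hpow k hk y hy0 (by linarith))
      exact_mod_cast Nat.one_le_iff_ne_zero.2 (Nat.factorial_ne_zero k)
    have e2 : ‖∑ j ∈ Finset.range (r + 1), ((τ ^ k * α).coeff j : ℂ) * (Complex.I * u) ^ j‖
        ≤ (∑ j ∈ Finset.range (r + 1), |(τ ^ k * α).coeff j|) * (1 + y) ^ r := by
      rw [Finset.sum_mul]
      refine norm_sum_le_of_le _ fun j hj => ?_
      rw [norm_mul, norm_pow, norm_mul, Complex.norm_I, one_mul, Complex.norm_real,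
        Complex.norm_real, Real.norm_eq_abs, Real.norm_eq_abs]
      gcongr
      exact hpow j hj |u| (abs_nonneg u) hu
    rw [norm_mul]
    calc _ ≤ (1 + y) ^ r * ((∑ j ∈ Finset.range (r + 1), |(τ ^ k * α).coeff j|) * (1 + y) ^ r) := by
          gcongr
      _ = _ := by rw [pow_add]; ring
  rw [hre]
  calc _ ≤ Real.exp (-(v * y / 2)) * (M * (C * Real.exp (v / 4 * y))) := by
        gcongr
        exact hsum.trans (by gcongr; exact hCb y hy0)
    _ = M * C * (Real.exp (-(v * y / 2)) * Real.exp (v / 4 * y)) := by ring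
    _ = _ := by rw [← Real.exp_add]; congr 2; ring

/-- The Edgeworth polynomials: `edgeworthSum` is the Fourier transform of a combination of real
polynomials times the Gaussian density. -/
theorem exists_edgeworth_polynomials {v : ℝ≥0} (hv : 0 < v) (τ α : ℝ[X]) (r : ℕ) :
    ∃ P : ℕ → ℝ[X], ∀ N : ℕ, 1 ≤ N → ∀ u : ℝ,
      edgeworthSum v τ α r N u = ∑ p ∈ Finset.range (r + 1),
        (((N : ℝ) ^ (-(p : ℝ) / 2) : ℝ) : ℂ) *
          ∫ z : ℝ, (((P p).eval z * gaussianPDFReal 0 v z : ℝ) : ℂ)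
            * Complex.exp (Complex.I * u * ((z * √N : ℝ) : ℂ)) := by
  -- With `s = u √N` one has `-N u² = (is)²` and `(iu) ^ j = N ^ (-j / 2) (is) ^ j`, so the terms of
  -- degree `j` in the inner sums form `N ^ (-j / 2)` times the polynomial `Q j` in `is`.
  set Q : ℕ → ℝ[X] := fun j => ∑ k ∈ Finset.range (r + 1),
    Polynomial.C ((τ ^ k * α).coeff j / k.factorial) * (Polynomial.X ^ 2) ^ k * Polynomial.X ^ j
    with hQ
  choose P hP using fun j => exists_polynomial_gaussian_fourier (Q j) hv
  refine ⟨P, fun N hN u => ?_⟩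
  have hN0 : (0 : ℝ) < N := by exact_mod_cast hN
  have hsq : ((√N : ℝ) : ℂ) ^ 2 = N := by
    rw [← Complex.ofReal_pow, Real.sq_sqrt hN0.le, Complex.ofReal_natCast]
  have hpow : ∀ p : ℕ, (((N : ℝ) ^ (-(p : ℝ) / 2) : ℝ) : ℂ) * ((√N : ℝ) : ℂ) ^ p = 1 := by
    intro p
    rw [← Complex.ofReal_pow, ← Complex.ofReal_mul, Real.sqrt_eq_rpow, ← Real.rpow_natCast,
      ← Real.rpow_mul hN0.le, ← Real.rpow_add hN0]
    rw [show -(p : ℝ) / 2 + 1 / 2 * p = 0 by ring, Real.rpow_zero, Complex.ofReal_one]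
  have hterm : ∀ p : ℕ, (((N : ℝ) ^ (-(p : ℝ) / 2) : ℝ) : ℂ) *
      ∫ z : ℝ, (((P p).eval z * gaussianPDFReal 0 v z : ℝ) : ℂ)
        * Complex.exp (Complex.I * u * ((z * √N : ℝ) : ℂ))
      = Complex.exp (-(v * (N * u ^ 2) / 2 : ℝ)) * ∑ k ∈ Finset.range (r + 1),
        (-(N * (u : ℂ) ^ 2)) ^ k / k.factorial * (((τ ^ k * α).coeff p : ℂ) * (Complex.I * u) ^ p) := by
    intro p
    have h1 : ∫ z : ℝ, (((P p).eval z * gaussianPDFReal 0 v z : ℝ) : ℂ)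
        * Complex.exp (Complex.I * u * ((z * √N : ℝ) : ℂ))
        = ∫ z : ℝ, (((P p).eval z * gaussianPDFReal 0 v z : ℝ) : ℂ)
        * Complex.exp (Complex.I * ((u * √N : ℝ) : ℂ) * z) := by
      refine integral_congr_ae (Eventually.of_forall fun z => ?_)
      simp only
      congr 2
      push_cast
      ring
    rw [h1, hP]
    have h2 : (v * (u * √N) ^ 2 / 2 : ℝ) = v * (N * u ^ 2) / 2 := by
      rw [mul_pow, Real.sq_sqrt hN0.le]; ring
    rw [h2, mul_comm (Polynomial.aeval _ _), mul_left_comm]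
    congr 1
    rw [hQ, map_sum, Finset.mul_sum]
    refine Finset.sum_congr rfl fun k _ => ?_
    simp only [map_mul, map_pow, Polynomial.aeval_X, Polynomial.aeval_C, Complex.coe_algebraMap]
    have h3 : (Complex.I * ((u * √N : ℝ) : ℂ)) ^ 2 = -(N * (u : ℂ) ^ 2) := by
      push_cast
      rw [mul_pow, mul_pow, Complex.I_sq, hsq]; ring
    have h4 : (Complex.I * ((u * √N : ℝ) : ℂ)) ^ p = (Complex.I * u) ^ p * ((√N : ℝ) : ℂ) ^ p := by
      push_cast
      rw [← mul_pow]; ring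
    rw [h3, h4]
    push_cast
    linear_combination ((τ ^ k * α).coeff p / k.factorial * (-(N * (u : ℂ) ^ 2)) ^ k
      * (Complex.I * u) ^ p) * hpow p
  rw [Finset.sum_congr rfl fun p _ => hterm p, ← Finset.mul_sum, Finset.sum_comm, edgeworthSum]
  congr 1
  exact Finset.sum_congr rfl fun k _ => Finset.mul_sum _ _ _

end EdgeworthSum

/-! ### Scaled Gaussian integrals and negligible sequences -/

section Scaling

theorem integrable_abs_pow_mul_exp {b : ℝ} (hb : 0 < b) (r : ℕ) :
    Integrable fun s : ℝ => |s| ^ r * (1 + s ^ 2) ^ (r + 1) * Real.exp (-(b * s ^ 2)) := by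
  have h := integrable_polynomial_mul_exp_neg_mul_sq
    ((1 + Polynomial.X ^ 2) ^ r * (1 + Polynomial.X ^ 2) ^ (r + 1)) hb
  refine h.mono' (by fun_prop) (Eventually.of_forall fun s => ?_)
  rw [Real.norm_of_nonneg (by positivity)]
  simp only [Polynomial.eval_mul, Polynomial.eval_pow, Polynomial.eval_add, Polynomial.eval_one,
    Polynomial.eval_X, neg_mul]
  have : |s| ≤ 1 + s ^ 2 := by rw [← sq_abs]; nlinarith [sq_nonneg (|s| - 1)]
  gcongr

theorem scaled_gaussian_eq {N : ℕ} (hN : 1 ≤ N) (b : ℝ) (r : ℕ) (u : ℝ) :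
    |u| ^ r * (1 + N * u ^ 2) ^ (r + 1) * Real.exp (-(b * (N * u ^ 2)))
      = (√N ^ r)⁻¹ * (|√N * u| ^ r * (1 + (√N * u) ^ 2) ^ (r + 1)
        * Real.exp (-(b * (√N * u) ^ 2))) := by
  have hN0 : (0 : ℝ) < N := by exact_mod_cast hN
  rw [mul_pow (√N) u 2, Real.sq_sqrt hN0.le, abs_mul, abs_of_nonneg (Real.sqrt_nonneg _), mul_pow]
  field_simp

/-- This is the source of the rate: under `s = √N u`, `|u| ^ r` contributes `N ^ (-r / 2)` and `du`
another `N ^ (-1 / 2)`. -/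
theorem integral_scaled_gaussian {N : ℕ} (hN : 1 ≤ N) {b : ℝ} (hb : 0 < b) (r : ℕ) :
    Integrable (fun u : ℝ => |u| ^ r * (1 + N * u ^ 2) ^ (r + 1) * Real.exp (-(b * (N * u ^ 2)))) ∧
    ∫ u : ℝ, |u| ^ r * (1 + N * u ^ 2) ^ (r + 1) * Real.exp (-(b * (N * u ^ 2)))
      = (N : ℝ) ^ (-((r : ℝ) + 1) / 2) *
        ∫ s : ℝ, |s| ^ r * (1 + s ^ 2) ^ (r + 1) * Real.exp (-(b * s ^ 2)) := by
  have hN0 : (0 : ℝ) < N := by exact_mod_cast hN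
  have hs : 0 < √(N : ℝ) := Real.sqrt_pos.2 hN0
  simp only [scaled_gaussian_eq hN]
  refine ⟨((integrable_abs_pow_mul_exp hb r).comp_mul_left' hs.ne').const_mul _, ?_⟩
  rw [integral_const_mul, Measure.integral_comp_mul_left
    (fun s : ℝ => |s| ^ r * (1 + s ^ 2) ^ (r + 1) * Real.exp (-(b * s ^ 2))), smul_eq_mul,
    ← mul_assoc]
  congr 1
  rw [abs_of_pos (by positivity), ← mul_inv, ← pow_succ, Real.sqrt_eq_rpow, ← Real.rpow_natCast,
    ← Real.rpow_mul hN0.le, ← Real.rpow_neg hN0.le]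
  congr 1
  push_cast
  ring

theorem tendsto_rpow_mul_pow {κ : ℝ} (hκ0 : 0 < κ) (hκ1 : κ < 1) (p : ℝ) :
    Tendsto (fun N : ℕ => (N : ℝ) ^ p * κ ^ N) atTop (𝓝 0) := by
  obtain ⟨k, hk⟩ := exists_nat_ge p
  refine squeeze_zero' (Eventually.of_forall fun N => by positivity) ?_
    (tendsto_pow_const_mul_const_pow_of_abs_lt_one k (by rwa [abs_of_pos hκ0]))
  filter_upwards [eventually_ge_atTop 1] with N hN
  have : (1 : ℝ) ≤ N := by exact_mod_cast hN
  rw [← Real.rpow_natCast (N : ℝ) k]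
  gcongr

theorem tendsto_rpow_mul_rpow {p s : ℝ} (h : p + s < 0) :
    Tendsto (fun N : ℕ => (N : ℝ) ^ p * (N : ℝ) ^ s) atTop (𝓝 0) := by
  have h1 := (tendsto_rpow_neg_atTop (y := -(p + s)) (by linarith)).comp
    (tendsto_natCast_atTop_atTop (R := ℝ))
  refine h1.congr' ?_
  filter_upwards [eventually_ge_atTop 1] with N hN
  have : (0 : ℝ) < N := by exact_mod_cast hN
  simp only [Function.comp_apply, neg_neg]
  rw [Real.rpow_add this]

end Scaling

end WeakEdgeworth

namespace WeakEdgeworth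

open Asymptotics
open scoped FourierTransform ComplexConjugate

/-! ### Characteristic functions and the central limit theorem -/

section CharacteristicFunctions

variable {Ω : Type*} [MeasurableSpace Ω] {μ : Measure Ω} [IsProbabilityMeasure μ]

theorem norm_charFun_le_one (S : Ω → ℝ) (u : ℝ) :
    ‖∫ ω, Complex.exp (Complex.I * u * S ω) ∂μ‖ ≤ 1 := by
  refine (norm_integral_le_of_norm_le_const (C := 1) (Eventually.of_forall fun ω => ?_)).trans
    (by simp)
  rw [mul_assoc, mul_comm, ← Complex.ofReal_mul, Complex.norm_exp_ofReal_mul_I]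

omit [IsProbabilityMeasure μ] in
theorem charFun_neg_eq_conj (S : Ω → ℝ) (u : ℝ) :
    ∫ ω, Complex.exp (Complex.I * (-u : ℝ) * S ω) ∂μ
      = conj (∫ ω, Complex.exp (Complex.I * u * S ω) ∂μ) := by
  rw [← integral_conj]
  refine integral_congr_ae (Eventually.of_forall fun ω => ?_)
  simp [← Complex.exp_conj]

omit [IsProbabilityMeasure μ] in
theorem integral_exp_sub (S : Ω → ℝ) (u b : ℝ) :
    ∫ ω, Complex.exp (Complex.I * u * ((S ω - b : ℝ) : ℂ)) ∂μ
      = (∫ ω, Complex.exp (Complex.I * u * S ω) ∂μ) * Complex.exp (-(Complex.I * u * b)) := by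
  rw [← integral_mul_const]
  refine integral_congr_ae (Eventually.of_forall fun ω => ?_)
  simp only [← Complex.exp_add]
  congr 1
  push_cast
  ring

/-- The central limit theorem for a sequence whose characteristic functions are quasi-powers near
the origin. -/
theorem satisfiesCLT_of_eigenvalue_expansion {S : ℕ → Ω → ℝ} (hS : ∀ N, Measurable (S N))
    {lam a : ℝ → ℂ} {C κ A : ℝ} {v : ℝ≥0} (hκ0 : 0 < κ) (hκ1 : κ < 1)
    (hlam : ContinuousAt lam 0) (hlam0 : lam 0 = 1) (hac : ContinuousAt a 0) (ha0 : a 0 = 1)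
    (hlog : (fun u : ℝ => Complex.log (lam u) - (Complex.I * u * A - v * (u : ℂ) ^ 2 / 2))
      =o[𝓝 0] fun u => u ^ 2)
    (h : ∀ᶠ u : ℝ in 𝓝 0, ∀ N : ℕ, 1 ≤ N →
      ‖(∫ ω, Complex.exp (Complex.I * u * S N ω) ∂μ) - lam u ^ N * a u‖ ≤ C * κ ^ N) :
    SatisfiesCLT μ S A v where
  forall_aemeasurable N := (((hS N).sub_const _).div_const _).aemeasurable
  tendsto := by
    refine ProbabilityMeasure.tendsto_iff_tendsto_charFun.2 fun s => ?_
    simp only [ProbabilityMeasure.coe_mk, Measure.map_id]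
    rw [charFun_gaussianReal]
    set u : ℕ → ℝ := fun N => s / √N with hu
    have hulim : Tendsto u atTop (𝓝 0) := by
      have h1 : Tendsto (fun N : ℕ => √(N : ℝ)) atTop atTop :=
        Real.tendsto_sqrt_atTop.comp tendsto_natCast_atTop_atTop
      exact h1.const_div_atTop s
    set err : ℝ → ℂ := fun u => Complex.log (lam u) - (Complex.I * u * A - v * (u : ℂ) ^ 2 / 2)
      with herr
    have hNu : ∀ N : ℕ, 1 ≤ N → (N : ℝ) * u N ^ 2 = s ^ 2 := by
      intro N hN
      have hN0 : (0 : ℝ) < N := by exact_mod_cast hN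
      rw [hu]
      simp only
      rw [div_pow, Real.sq_sqrt hN0.le]
      field_simp
    -- The error is `N * o(u_N²)`, while `N u_N² = s²` stays fixed.
    have hNerr : Tendsto (fun N : ℕ => (N : ℂ) * err (u N)) atTop (𝓝 0) := by
      have h1 : (fun N : ℕ => (N : ℂ) * err (u N)) =o[atTop] fun N : ℕ => (N : ℝ) * u N ^ 2 :=
        IsBigO.mul_isLittleO (IsBigO.of_bound 1 (by simp)) (hlog.comp_tendsto hulim)
      refine (isLittleO_one_iff ℝ).1 (h1.trans_isBigO (IsBigO.of_bound (s ^ 2) ?_))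
      filter_upwards [eventually_ge_atTop 1] with N hN
      rw [hNu N hN]
      simp
    have hne : ∀ᶠ u in 𝓝 (0 : ℝ), lam u ≠ 0 :=
      hlam.eventually_ne (by rw [hlam0]; exact one_ne_zero)
    have hdiff : Tendsto (fun N : ℕ => ((∫ ω, Complex.exp (Complex.I * u N * S N ω) ∂μ)
        - lam (u N) ^ N * a (u N)) * Complex.exp (-(Complex.I * u N * (N * A : ℝ)))) atTop (𝓝 0) := by
      refine squeeze_zero_norm' (a := fun N => C * κ ^ N) ?_ ?_
      · filter_upwards [hulim.eventually h, eventually_ge_atTop 1] with N hN hN1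
        rw [norm_mul]
        have : ‖Complex.exp (-(Complex.I * u N * (N * A : ℝ)))‖ = 1 := by
          rw [show -(Complex.I * u N * (N * A : ℝ)) = ((-(u N * (N * A)) : ℝ) : ℂ) * Complex.I by
            push_cast; ring, Complex.norm_exp_ofReal_mul_I]
        rw [this, mul_one]
        exact hN N hN1
      · simpa using (tendsto_pow_atTop_nhds_zero_of_lt_one hκ0.le hκ1).const_mul C
    have hmain : Tendsto (fun N : ℕ => Complex.exp (-(v * s ^ 2 / 2 : ℝ) + N * err (u N)) * a (u N))
        atTop (𝓝 (Complex.exp (-(v * s ^ 2 / 2 : ℝ) + 0) * 1)) := by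
      refine Tendsto.mul ((tendsto_const_nhds.add hNerr).cexp) ?_
      rw [← ha0]
      exact hac.tendsto.comp hulim
    have hsum := hdiff.add hmain
    refine (hsum.congr' ?_).trans (le_of_eq ?_)
    · filter_upwards [hulim.eventually hne, eventually_ge_atTop 1] with N hN hN1
      have e1 : lam (u N) ^ N * Complex.exp (-(Complex.I * u N * (N * A : ℝ)))
          = Complex.exp (-(v * s ^ 2 / 2 : ℝ) + N * err (u N)) := by
        have : lam (u N) ^ N = Complex.exp (N * Complex.log (lam (u N))) := by
          rw [Complex.exp_nat_mul, Complex.exp_log hN]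
        rw [this, ← Complex.exp_add, ← hNu N hN1, herr]
        congr 1
        push_cast
        ring
      rw [charFun_apply_real, integral_map (((hS N).sub_const _).div_const _).aemeasurable
        (by fun_prop)]
      have e2 : ∫ ω, Complex.exp ((s : ℂ) * (((S N ω - N * A) / √N : ℝ) : ℂ) * Complex.I) ∂μ
          = (∫ ω, Complex.exp (Complex.I * u N * S N ω) ∂μ)
            * Complex.exp (-(Complex.I * u N * (N * A : ℝ))) := by
        rw [← integral_exp_sub]
        refine integral_congr_ae (Eventually.of_forall fun ω => ?_)
        simp only [hu]
        congr 1
        push_cast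
        ring
      rw [e2, ← e1]
      ring
    · congr 1
      rw [zero_add, mul_one, add_zero]
      congr 1
      push_cast
      ring

end CharacteristicFunctions

end WeakEdgeworth

namespace WeakEdgeworth

open Asymptotics
open scoped FourierTransform ComplexConjugate

/-! ### From bounds on characteristic functions to the weak expansion -/

section Expansion

variable {Ω : Type*} [MeasurableSpace Ω] {μ : Measure Ω} [IsProbabilityMeasure μ]

/-- The expectation and every term of the expansion are integrals of `f` against finite measures, so
one Parseval formula turns their difference into a difference of transforms tested against `𝓕 f`. -/
theorem expectation_sub_expansion_eq {v : ℝ≥0} (hv : 0 < v) {τ α : ℝ[X]} {r : ℕ} {P : ℕ → ℝ[X]}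
    (hP : ∀ N : ℕ, 1 ≤ N → ∀ u : ℝ,
      edgeworthSum v τ α r N u = ∑ p ∈ Finset.range (r + 1),
        (((N : ℝ) ^ (-(p : ℝ) / 2) : ℝ) : ℂ) *
          ∫ z : ℝ, (((P p).eval z * gaussianPDFReal 0 v z : ℝ) : ℂ)
            * Complex.exp (Complex.I * u * ((z * √N : ℝ) : ℂ)))
    {m k : ℕ} (hm : 2 ≤ m) {f : ℝ → ℂ} (hf : f ∈ testSpace m k) {Y : Ω → ℝ} (hY : Measurable Y)
    {N : ℕ} (hN : 1 ≤ N) :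
    (∫ ω, f (Y ω) ∂μ) - ∑ p ∈ Finset.range (r + 1), (((N : ℝ) ^ (-(p : ℝ) / 2) : ℝ) : ℂ) *
        ∫ z : ℝ, (((P p).eval z * gaussianPDFReal 0 v z : ℝ) : ℂ) * f (z * √N)
      = ∫ t : ℝ, 𝓕 f t * ((∫ ω, Complex.exp (Complex.I * ((2 * Real.pi * t : ℝ) : ℂ) * Y ω) ∂μ)
        - edgeworthSum v τ α r N (2 * Real.pi * t)) := by
  obtain ⟨i1, e1⟩ := integral_comp_eq_integral_fourier hm hf (integrable_const (μ := μ) (1 : ℂ)) hY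
  simp only [one_mul] at i1 e1
  have h2 := fun p => integral_comp_eq_integral_fourier hm hf
    (integrable_polynomial_mul_gaussianPDFReal (P p) hv).ofReal
    (measurable_id.mul_const (√(N : ℝ)))
  have i2 : ∀ p ∈ Finset.range (r + 1), Integrable fun t : ℝ =>
      (((N : ℝ) ^ (-(p : ℝ) / 2) : ℝ) : ℂ) * (𝓕 f t *
        ∫ z : ℝ, (((P p).eval z * gaussianPDFReal 0 v z : ℝ) : ℂ)
          * Complex.exp (Complex.I * ((2 * Real.pi * t : ℝ) : ℂ) * ((z * √N : ℝ) : ℂ))) :=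
    fun p _ => (h2 p).1.const_mul _
  have e2 : ∑ p ∈ Finset.range (r + 1), (((N : ℝ) ^ (-(p : ℝ) / 2) : ℝ) : ℂ) *
        ∫ z : ℝ, (((P p).eval z * gaussianPDFReal 0 v z : ℝ) : ℂ) * f (z * √N)
      = ∫ t : ℝ, ∑ p ∈ Finset.range (r + 1), (((N : ℝ) ^ (-(p : ℝ) / 2) : ℝ) : ℂ) * (𝓕 f t *
        ∫ z : ℝ, (((P p).eval z * gaussianPDFReal 0 v z : ℝ) : ℂ)
          * Complex.exp (Complex.I * ((2 * Real.pi * t : ℝ) : ℂ) * ((z * √N : ℝ) : ℂ))) := by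
    rw [integral_finsetSum _ i2]
    refine Finset.sum_congr rfl fun p _ => ?_
    rw [integral_const_mul]
    congr 1
    exact (h2 p).2
  rw [e1, e2, ← integral_sub i1 (integrable_finsetSum _ i2)]
  refine integral_congr_ae (Eventually.of_forall fun t => ?_)
  simp only
  rw [hP N hN, mul_sub, Finset.mul_sum]
  congr 1
  exact Finset.sum_congr rfl fun p _ => by ring

/-- Weak Edgeworth expansions from bounds on characteristic functions. -/
theorem admitsWeakGlobalExpansion_of_bounds {S : ℕ → Ω → ℝ} (hS : ∀ N, Measurable (S N))
    {A : ℝ} {v : ℝ≥0} (hv : 0 < v) {τ α : ℝ[X]} {r q : ℕ} {r₁ c : ℝ} (hc : 0 < c)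
    (hr₁ : 0 < r₁) (hq : ((r : ℝ) + 1) / (2 * r₁) < q)
    (hbound : ∀ ε > 0, ∃ η : ℕ → ℝ, (∀ N, 0 ≤ η N) ∧
      Tendsto (fun N : ℕ => (N : ℝ) ^ (((r : ℝ) + 1) / 2) * η N) atTop (𝓝 0) ∧
      ∀ᶠ N : ℕ in atTop, ∀ u : ℝ,
        ‖(∫ ω, Complex.exp (Complex.I * u * ((S N ω - N * A : ℝ) : ℂ)) ∂μ)
            - edgeworthSum v τ α r N u‖
          ≤ ε * (|u| ^ r * (1 + N * u ^ 2) ^ (r + 1) * Real.exp (-(v / 4 * (N * u ^ 2))))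
            + η N + if c * (N : ℝ) ^ r₁ < |u| then 1 else 0) :
    AdmitsWeakGlobalExpansion μ S A v r (testSpace (q + 2) 0) (testNorm (q + 2) 0) := by
  have hv' : (0 : ℝ) < v / 4 := div_pos hv (by norm_num)
  obtain ⟨P, hP⟩ := exists_edgeworth_polynomials hv τ α r
  refine ⟨P, fun ε hε => ?_⟩
  set J := ∫ s : ℝ, |s| ^ r * (1 + s ^ 2) ^ (r + 1) * Real.exp (-(v / 4 * s ^ 2)) with hJ
  have hJ0 : 0 ≤ J := integral_nonneg fun s => by positivity
  -- Half of `ε` pays for the Gaussian part, whose integral is `J N ^ (-(r + 1) / 2)`; `J + 1`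
  -- avoids division by zero. The other half pays for `η` and the tail.
  obtain ⟨η, hη0, hηlim, hη⟩ := hbound (ε / (2 * (J + 1))) (by positivity)
  have htail : Tendsto (fun N : ℕ => (N : ℝ) ^ (((r : ℝ) + 1) / 2)
      * ((c * (N : ℝ) ^ r₁) ^ q)⁻¹) atTop (𝓝 0) := by
    rw [div_lt_iff₀ (by positivity)] at hq
    have h1 := (tendsto_rpow_mul_rpow (p := ((r : ℝ) + 1) / 2) (s := -(r₁ * q))
      (by linarith)).const_mul (c ^ q)⁻¹
    rw [mul_zero] at h1
    refine h1.congr fun N => ?_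
    rw [Real.rpow_neg (Nat.cast_nonneg N), Real.rpow_mul (Nat.cast_nonneg N), Real.rpow_natCast,
      mul_pow, mul_inv]
    ring
  have hlim := (hηlim.add htail).const_mul (2 * Real.pi)
  rw [add_zero, mul_zero] at hlim
  filter_upwards [hη, hlim.eventually (gt_mem_nhds (show 0 < ε / 2 by linarith)),
    eventually_ge_atTop 1] with N hN1 hN2 hN f hf
  have hN0 : (0 : ℝ) < N := by exact_mod_cast hN
  obtain ⟨hint, hval⟩ := integral_scaled_gaussian hN hv' r
  rw [expectation_sub_expansion_eq hv hP (by omega) hf ((hS N).sub_const _) hN]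
  have hT : 0 < c * (N : ℝ) ^ r₁ := by positivity
  have hmain := norm_integral_fourier_mul_le hf (Δ := fun u =>
    (∫ ω, Complex.exp (Complex.I * u * ((S N ω - N * A : ℝ) : ℂ)) ∂μ) - edgeworthSum v τ α r N u)
    (hint.const_mul (ε / (2 * (J + 1)))) (fun u => by positivity) (hη0 N) hT hN1
  refine hmain.trans ?_
  rw [integral_const_mul, hval]
  refine mul_le_mul_of_nonneg_left ?_ ENNReal.toReal_nonneg
  set p : ℝ := ((r : ℝ) + 1) / 2 with hp
  have hpneg : -((r : ℝ) + 1) / 2 = -p := by rw [hp]; ring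
  rw [hpneg]
  have hNp : 0 < (N : ℝ) ^ p := by positivity
  have h1 : ε / (2 * (J + 1)) * ((N : ℝ) ^ (-p) * J) ≤ ε / 2 * (N : ℝ) ^ (-p) := by
    have : ε / (2 * (J + 1)) * J ≤ ε / 2 := by
      rw [div_mul_eq_mul_div, div_le_div_iff₀ (by positivity) (by norm_num)]
      nlinarith
    calc _ = (ε / (2 * (J + 1)) * J) * (N : ℝ) ^ (-p) := by ring
      _ ≤ _ := by gcongr
  have h2 : 2 * Real.pi * (η N + ((c * (N : ℝ) ^ r₁) ^ q)⁻¹) ≤ ε / 2 * (N : ℝ) ^ (-p) := by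
    rw [Real.rpow_neg hN0.le, ← div_eq_mul_inv, le_div_iff₀ hNp]
    refine le_trans (le_of_eq ?_) hN2.le
    ring
  linarith

end Expansion

/-! ### Estimates over all frequency ranges -/

section Operators

variable {B : Type*} [NormedAddCommGroup B] [NormedSpace ℂ B] [CompleteSpace B]

theorem partialSum_measurable {Ω : Type*} [MeasurableSpace Ω] {X : ℕ → Ω → ℝ}
    (hX : ∀ n, Measurable (X n)) (N : ℕ) : Measurable (partialSum X N) :=
  Finset.measurable_sum _ fun n _ => hX n

/-- The estimates on the characteristic function over all frequency ranges. -/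
theorem charFun_sub_edgeworthSum_bound {φ : ℕ → ℝ → ℂ} (hφ1 : ∀ N u, ‖φ N u‖ ≤ 1)
    {L : ℝ → B →L[ℂ] B} {w : B} {l : B →L[ℂ] ℂ}
    (hφ : ∀ N : ℕ, 1 ≤ N → ∀ t, φ N t = l ((L t ^ N) w))
    (hL : Continuous L) (hA3 : SpectrumInsideDisk L) {r₁ K c C₁ D : ℝ} (hC₁ : 0 ≤ C₁)
    (hdec : ∀ᶠ N : ℕ in atTop, ∀ t : ℝ, K ≤ |t| → |t| ≤ c * (N : ℝ) ^ r₁ →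
      ‖L t ^ N‖ ≤ C₁ * (N : ℝ) ^ (-D))
    {lam a : ℝ → ℂ} {C κ A : ℝ} (hC : 0 ≤ C) (hκ0 : 0 < κ) (hκ1 : κ < 1)
    (happrox : ∀ᶠ u : ℝ in 𝓝 0, ∀ N : ℕ, 1 ≤ N → ‖φ N u - lam u ^ N * a u‖ ≤ C * κ ^ N)
    {v : ℝ≥0} (hv : 0 < v) {τ α : ℝ[X]} {r : ℕ} (hD : ((r : ℝ) + 1) / 2 < D)
    {ε : ℝ} (hε : 0 < ε)
    (hlocal : ∀ᶠ u : ℝ in 𝓝 0, ∀ N : ℕ,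
      ‖lam u ^ N * a u * Complex.exp (-(Complex.I * u * (N * A))) - edgeworthSum v τ α r N u‖
      ≤ ε * |u| ^ r * (1 + N * u ^ 2) ^ (r + 1) * Real.exp (-(v / 4 * (N * u ^ 2)))) :
    ∃ η : ℕ → ℝ, (∀ N, 0 ≤ η N) ∧
      Tendsto (fun N : ℕ => (N : ℝ) ^ (((r : ℝ) + 1) / 2) * η N) atTop (𝓝 0) ∧
      ∀ᶠ N : ℕ in atTop, ∀ u : ℝ,
        ‖φ N u * Complex.exp (-(Complex.I * u * (N * A))) - edgeworthSum v τ α r N u‖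
          ≤ ε * (|u| ^ r * (1 + N * u ^ 2) ^ (r + 1) * Real.exp (-(v / 4 * (N * u ^ 2))))
            + η N + if c * (N : ℝ) ^ r₁ < |u| then 1 else 0 := by
  have hv' : (0 : ℝ) < v := hv
  obtain ⟨δ, hδ, hnear⟩ := Metric.eventually_nhds_iff.1 (happrox.and hlocal)
  obtain ⟨C₂, κ₂, hC₂, hκ₂0, hκ₂1, hmid⟩ := hA3.exists_norm_pow_le hL hδ K
  obtain ⟨C₃, hC₃, hG⟩ := exists_norm_edgeworthSum_le hv τ α r
  set κ₃ := Real.exp (-(v / 4 * δ ^ 2)) with hκ₃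
  have hκ₃0 : 0 < κ₃ := Real.exp_pos _
  have hκ₃1 : κ₃ < 1 := by
    have : 0 < (v : ℝ) / 4 * δ ^ 2 := by positivity
    rw [hκ₃, ← Real.exp_zero]
    exact Real.exp_lt_exp.2 (by linarith)
  -- In order: the remainder of the quasi-power near `0`, the operator powers on `δ ≤ |u| ≤ K`, the
  -- Edgeworth sum for `|u| ≥ δ`, and the range controlled by (A4).
  refine ⟨fun N => C * κ ^ N + ‖l‖ * ‖w‖ * C₂ * κ₂ ^ N + C₃ * κ₃ ^ N
    + ‖l‖ * ‖w‖ * C₁ * (N : ℝ) ^ (-D), fun N => by positivity, ?_, ?_⟩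
  · set p := ((r : ℝ) + 1) / 2 with hp
    have h := ((((tendsto_rpow_mul_pow hκ0 hκ1 p).const_mul C).add
      ((tendsto_rpow_mul_pow hκ₂0 hκ₂1 p).const_mul (‖l‖ * ‖w‖ * C₂))).add
      ((tendsto_rpow_mul_pow hκ₃0 hκ₃1 p).const_mul C₃)).add
      ((tendsto_rpow_mul_rpow (p := p) (s := -D) (by linarith)).const_mul (‖l‖ * ‖w‖ * C₁))
    simp only [mul_zero, add_zero] at h
    exact h.congr fun N => by ring
  · filter_upwards [hdec, eventually_ge_atTop 1] with N hN hN1 u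
    have hE : ‖Complex.exp (-(Complex.I * u * (N * A)))‖ = 1 := by
      rw [show -(Complex.I * u * (N * A)) = ((-(u * (N * A)) : ℝ) : ℂ) * Complex.I by
        push_cast; ring, Complex.norm_exp_ofReal_mul_I]
    have hg0 : 0 ≤ ε * (|u| ^ r * (1 + N * u ^ 2) ^ (r + 1) * Real.exp (-(v / 4 * (N * u ^ 2)))) := by
      positivity
    have q1 : 0 ≤ C * κ ^ N := by positivity
    have q2 : 0 ≤ ‖l‖ * ‖w‖ * C₂ * κ₂ ^ N := by positivity
    have q3 : 0 ≤ C₃ * κ₃ ^ N := by positivity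
    have q4 : 0 ≤ ‖l‖ * ‖w‖ * C₁ * (N : ℝ) ^ (-D) := by positivity
    have q5 : (0 : ℝ) ≤ if c * (N : ℝ) ^ r₁ < |u| then 1 else 0 := by split_ifs <;> norm_num
    rcases lt_or_ge |u| δ with hu | hu
    · obtain ⟨h1, h2⟩ := hnear (y := u) (by rwa [dist_zero_right])
      have h3 : ‖φ N u * Complex.exp (-(Complex.I * u * (N * A)))
          - lam u ^ N * a u * Complex.exp (-(Complex.I * u * (N * A)))‖ ≤ C * κ ^ N := by
        rw [← sub_mul, norm_mul, hE, mul_one]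
        exact h1 N hN1
      have h4 := norm_sub_le_norm_sub_add_norm_sub
        (φ N u * Complex.exp (-(Complex.I * u * (N * A))))
        (lam u ^ N * a u * Complex.exp (-(Complex.I * u * (N * A)))) (edgeworthSum v τ α r N u)
      have h5 := h2 N
      have h6 : ε * |u| ^ r * (1 + N * u ^ 2) ^ (r + 1) * Real.exp (-(v / 4 * (N * u ^ 2)))
          = ε * (|u| ^ r * (1 + N * u ^ 2) ^ (r + 1) * Real.exp (-(v / 4 * (N * u ^ 2)))) := by ring
      linarith
    · have hGu : ‖edgeworthSum v τ α r N u‖ ≤ C₃ * κ₃ ^ N := by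
        refine (hG N hN1 u).trans ?_
        gcongr
        rw [hκ₃, ← Real.exp_nat_mul]
        refine Real.exp_le_exp.2 ?_
        have : δ ^ 2 ≤ u ^ 2 := by rw [← sq_abs u]; gcongr
        have : (v : ℝ) / 4 * N * δ ^ 2 ≤ v / 4 * N * u ^ 2 := by gcongr
        linarith
      have hop : ‖φ N u‖ ≤ ‖l‖ * ‖w‖ * ‖L u ^ N‖ := by
        rw [hφ N hN1]
        calc _ ≤ ‖l‖ * ‖(L u ^ N) w‖ := l.le_opNorm _
          _ ≤ ‖l‖ * (‖L u ^ N‖ * ‖w‖) := by gcongr; exact ContinuousLinearMap.le_opNorm _ _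
          _ = _ := by ring
      have hφu : ‖φ N u‖ ≤ ‖l‖ * ‖w‖ * C₂ * κ₂ ^ N + ‖l‖ * ‖w‖ * C₁ * (N : ℝ) ^ (-D)
          + if c * (N : ℝ) ^ r₁ < |u| then 1 else 0 := by
        rcases le_or_gt |u| K with huK | huK
        · have : ‖l‖ * ‖w‖ * ‖L u ^ N‖ ≤ ‖l‖ * ‖w‖ * (C₂ * κ₂ ^ N) := by
            gcongr; exact hmid u hu huK N
          linarith
        · split_ifs with h
          · linarith [hφ1 N u]
          · have : ‖l‖ * ‖w‖ * ‖L u ^ N‖ ≤ ‖l‖ * ‖w‖ * (C₁ * (N : ℝ) ^ (-D)) := by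
              gcongr; exact hN u huK.le (not_lt.1 h)
            linarith
      have h1 := norm_sub_le (φ N u * Complex.exp (-(Complex.I * u * (N * A))))
        (edgeworthSum v τ α r N u)
      rw [norm_mul, hE, mul_one] at h1
      linarith

end Operators

end WeakEdgeworth

theorem mainTheorem5
    {Ω : Type*} [MeasurableSpace Ω] (μ : Measure Ω) [IsProbabilityMeasure μ]
    (X : ℕ → Ω → ℝ) (hX : ∀ n, Measurable (X n))
    {B : Type*} [NormedAddCommGroup B] [NormedSpace ℂ B] [CompleteSpace B]
    (L : ℝ → B →L[ℂ] B) (v : B) (l : B →L[ℂ] ℂ)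
    (hchar : ∀ N : ℕ, 1 ≤ N → ∀ t : ℝ,
      ∫ ω, Complex.exp (Complex.I * t * WeakEdgeworth.partialSum X N ω) ∂μ = l ((L t ^ N) v))
    (r q : ℕ) (r₁ : ℝ) (hr₁ : 0 < r₁)
    (hA1 : WeakEdgeworth.RegularFamily (r + 2) L)
    (hA2 : WeakEdgeworth.HasSpectralGap (L 0))
    (hA3 : WeakEdgeworth.SpectrumInsideDisk L)
    (hA4 : WeakEdgeworth.PolynomialDecay r₁ L)
    (hq : ((r : ℝ) + 1) / (2 * r₁) < q) :
    ∃ (A : ℝ) (σsq : ℝ≥0),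
      WeakEdgeworth.SatisfiesCLT μ (WeakEdgeworth.partialSum X) A σsq ∧
      (0 < σsq →
        WeakEdgeworth.AdmitsWeakGlobalExpansion μ (WeakEdgeworth.partialSum X) A σsq r
          (WeakEdgeworth.testSpace (q + 2) 0) (WeakEdgeworth.testNorm (q + 2) 0)) := by
  set S := WeakEdgeworth.partialSum X with hS
  have hSm : ∀ N, Measurable (S N) := WeakEdgeworth.partialSum_measurable hX
  set φ : ℕ → ℝ → ℂ := fun N u => ∫ ω, Complex.exp (Complex.I * u * S N ω) ∂μ with hφ
  have hφ0 : ∀ N, φ N 0 = 1 := fun N => by simp [hφ]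
  have hφ1 : ∀ N u, ‖φ N u‖ ≤ 1 := fun N u => WeakEdgeworth.norm_charFun_le_one (S N) u
  have hφL : ∀ N : ℕ, 1 ≤ N → ∀ t, φ N t = l ((L t ^ N) v) := hchar
  obtain ⟨hLc, δ, hδ, hLd⟩ := hA1
  have hL0 : ContDiffAt ℝ (r + 2 : ℕ) L 0 := hLd.contDiffAt (Icc_mem_nhds (by linarith) hδ)
  obtain ⟨lam, a, C, κ, hlam, ha, hlam0, hC, hκ0, hκ1, happrox⟩ :=
    WeakEdgeworth.exists_eigenvalue_expansion (by omega) hL0 hA2 v l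
  have happrox' : ∀ᶠ u : ℝ in 𝓝 0, ∀ N : ℕ, 1 ≤ N → ‖φ N u - lam u ^ N * a u‖ ≤ C * κ ^ N := by
    filter_upwards [happrox] with u hu N hN
    rw [hφL N hN]
    exact hu N hN
  obtain ⟨ha0, hle, hsymm⟩ := WeakEdgeworth.eigenvalue_symmetry hφ0 hφ1
    (fun N u => WeakEdgeworth.charFun_neg_eq_conj (S N) u) hlam.continuousAt ha.continuousAt hlam0
    hC hκ0 hκ1 happrox'
  obtain ⟨A, σ, τ, hτ, hlog⟩ := WeakEdgeworth.exists_log_expansion hlam hlam0 hle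
    (hsymm.mono fun u hu => hu.1)
  refine ⟨A, σ, ?_, fun hσ => ?_⟩
  · exact WeakEdgeworth.satisfiesCLT_of_eigenvalue_expansion hSm hκ0 hκ1 hlam.continuousAt hlam0
      ha.continuousAt ha0 (WeakEdgeworth.isLittleO_sq_of_log_expansion hτ hlog) happrox'
  · obtain ⟨α, hα⟩ := WeakEdgeworth.exists_polynomial_isLittleO
      (ha.of_le (m := (r : ℕ)) (by exact_mod_cast Nat.le_add_right r 2)) (hsymm.mono fun u hu => hu.2)
    -- Any exponent above `(r + 1) / 2` would serve for `D`.
    obtain ⟨K, c, C₁, -, hc, hC₁, hdec⟩ :=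
      hA4.exists_norm_pow_le hr₁ (D := ((r : ℝ) + 2) / 2) (by positivity)
    refine WeakEdgeworth.admitsWeakGlobalExpansion_of_bounds (τ := τ) (α := α) hSm hσ hc hr₁ hq
      fun ε hε => ?_
    obtain ⟨η, hη0, hηlim, hη⟩ := WeakEdgeworth.charFun_sub_edgeworthSum_bound (A := A) hφ1 hφL hLc
      hA3 hC₁ hdec hC hκ0 hκ1 happrox' hσ (by linarith) hε
      (WeakEdgeworth.local_edgeworth hσ hτ hlam.continuousAt hlam0 hlog ha.continuousAt ha0 hα hε)
    refine ⟨η, hη0, hηlim, hη.mono fun N hN u => ?_⟩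
    rw [WeakEdgeworth.integral_exp_sub, Complex.ofReal_mul, Complex.ofReal_natCast]
    exact hN u
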